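/- Let $\gamma>0$, $\bar\rho>0$, $s>s_0>2$ and $T>0$. For a velocity $v=(v^1,v^2,v^3)$ and a logarithmic density $\boldsymbol\rho=\ln(\rho/\bar\rho)$ on $[0,T]\times\mathbb R^3$, consider the reduced compressible Euler system $$\mathbf T v^i=-c_s^2\,\partial_i\boldsymbol\rho\quad(i=1,2,3),\qquad \mathbf T\boldsymbol\rho=-\operatorname{div}v,\qquad \mathbf T=\partial_t+v\cdot\nabla,$$ where $p(\rho)=\rho^\gamma$, $\rho=\bar\rho e^{\boldsymbol\rho}$, $c_s=\sqrt{dp/d\rho}$, and let $\varpi=\rho^{-1}\operatorname{curl}v$ be the specific vorticity. By a solution $(v,\boldsymbol\rho,\varpi)$ on $[0,T]$ we mean $v,\boldsymbol\rho\in L^\infty([0,T];H^s(\mathbb R^3))$ that are differentiable in time with values in $L^2(\mathbb R^3)$ and satisfy the system (with weak space derivatives, almost everywhere in $x$, for every $t\in[0,T]$), with $\varpi=\rho^{-1}\operatorname{curl}v$, and such that $dv,d\boldsymbol\rho\in L^2([0,T];L^\infty(\mathbb R^3))$, where $d=(\mathbf T,\partial_1,\partial_2,\partial_3)$. Let $v_0,\boldsymbol\rho_0\in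 H^s(\mathbb R^3)$ with $\varpi_0=\bar\rho^{-1}e^{-\boldsymbol\rho_0}\operatorname{curl}v_0\in H^{s_0}(\mathbb R^3)$, and let $(v,\boldsymbol\rho,\varpi)$ and $(\varphi,\psi,V)$ be two solutions on $[0,T]$ with the initial data $(v,\boldsymbol\rho)|_{t=0}=(\varphi,\psi)|_{t=0}=(v_0,\boldsymbol\rho_0)$. Then $$v=\varphi,\qquad \boldsymbol\rho=\psi,\qquad \varpi=V\qquad\text{on }[0,T].$$ -/

import Mathlib

open MeasureTheory Set
open scoped ContDiff ENNReal SchwartzMap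

noncomputable section

namespace CompressibleEuler

/-- Physical space `ℝ³`. -/
abbrev Space : Type := EuclideanSpace ℝ (Fin 3)

/-- Real-valued functions in `L²(ℝ³)`, modulo equality almost everywhere. -/
abbrev L2 : Type := Lp ℝ 2 (volume : Measure Space)

/-- A real `L²` function, seen as a complex `L²` function. -/
def complexify (f : L2) : Lp ℂ 2 (volume : Measure Space) :=
  Complex.ofRealCLM.compLp f

/-- `f ∈ H^s(ℝ³)`, in Mathlib's sense: `(1 + |ξ|²)^(s/2) f̂ ∈ L²`. -/
def MemHs (s : ℝ) (f : L2) : Prop :=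
  TemperedDistribution.MemSobolev s 2 (complexify f : 𝓢'(Space, ℂ))

/-- `f ∈ H^s(ℝ³)` and `‖f‖_{H^s} ≤ C`: the `L²` function representing the Bessel potential
of order `s` of `f` has norm at most `C`. -/
def HsNormLE (s : ℝ) (f : L2) (C : ℝ) : Prop :=
  ∃ g : Lp ℂ 2 (volume : Measure Space),
    TemperedDistribution.besselPotential Space ℂ s (complexify f : 𝓢'(Space, ℂ)) = g ∧ ‖g‖ ≤ C

/-- `g` is the weak derivative `∂_j f`. -/
def IsWeakDeriv (j : Fin 3) (f g : L2) : Prop :=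
  ∀ φ : Space → ℝ, ContDiff ℝ ∞ φ → HasCompactSupport φ →
    ∫ x, f x * fderiv ℝ φ x (EuclideanSpace.single j 1) = - ∫ x, g x * φ x

open Classical in
/-- The weak derivative `∂_j f` of an `L²` function when it exists in `L²` (it does for
`f ∈ H^s` with `s ≥ 1`), and `0` otherwise. -/
def weakDeriv (j : Fin 3) (f : L2) : L2 :=
  if h : ∃ g : L2, IsWeakDeriv j f g then h.choose else 0

/-- `(curl v)^i = ∂_{i+1} v^{i+2} - ∂_{i+2} v^{i+1}`, indices modulo `3`. -/
def curl (v : Fin 3 → L2) (i : Fin 3) : L2 :=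
  weakDeriv (i + 1) (v (i + 2)) - weakDeriv (i + 2) (v (i + 1))

/-- The equation of state `p(ϱ) = ϱ^γ`, in terms of the physical density `ϱ`. -/
def pressure (γ : ℝ) (ϱ : ℝ) : ℝ := ϱ ^ γ

/-- The physical density `ϱ = ϱ̄ e^r` whose logarithmic density is `r = ln (ϱ / ϱ̄)`. -/
def density (ρbar r : ℝ) : ℝ := ρbar * Real.exp r

/-- The speed of sound `c_s = √(dp/dϱ)` as a function of the logarithmic density. -/
def soundSpeed (γ ρbar r : ℝ) : ℝ := √(deriv (pressure γ) (density ρbar r))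

/-- `ϖ` is the specific vorticity `ϱ⁻¹ curl v`, where `ρ` is the logarithmic density. -/
def IsSpecificVorticity (ρbar : ℝ) (v : Fin 3 → L2) (ρ : L2) (ϖ : Fin 3 → L2) : Prop :=
  ∀ i, ∀ᵐ x : Space, ϖ i x = (density ρbar (ρ x))⁻¹ * curl v i x

/-- The square of the norm of `f` in `L²([0,T]; L^∞(ℝ³))`. -/
def normSqL2Linfty (T : ℝ) (f : ℝ → L2) : ℝ≥0∞ :=
  ∫⁻ t in Icc 0 T, (eLpNorm (f t) ⊤ (volume : Measure Space)) ^ 2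

/-- `(v, ρ, ϖ)` is a solution on `[0,T] × ℝ³`, with velocity `v`, logarithmic density `ρ` and
specific vorticity `ϖ`, of the reduced compressible Euler system
`𝐓 v^i = - c_s² ∂_i ρ`, `𝐓 ρ = - div v`, where `𝐓 = ∂_t + v · ∇`,
in the regularity class `v, ρ ∈ L^∞_t H^s` and `dv, dρ ∈ L²_t L^∞_x`.
The time derivatives are taken in `L²(ℝ³)` (one-sided at the end points), so that `v` and `ρ`
are in particular continuous in time with values in `L²(ℝ³)`.
Of `d = (𝐓, ∂₁, ∂₂, ∂₃)` only the space derivatives are mentioned in the last two fields,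
because `𝐓 v` and `𝐓 ρ` are given in terms of them by the equations, `ρ` being bounded. -/
structure IsSolution (γ ρbar s T : ℝ) (v : ℝ → Fin 3 → L2) (ρ : ℝ → L2)
    (ϖ : ℝ → Fin 3 → L2) : Prop where
  momentum : ∀ t ∈ Icc 0 T, ∀ i, ∃ dtv : L2,
    HasDerivWithinAt (fun τ => v τ i) dtv (Icc 0 T) t ∧
    ∀ᵐ x : Space, dtv x + ∑ j, v t j x * weakDeriv j (v t i) x
      = - (soundSpeed γ ρbar (ρ t x)) ^ 2 * weakDeriv i (ρ t) x
  continuity : ∀ t ∈ Icc 0 T, ∃ dtρ : L2,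
    HasDerivWithinAt ρ dtρ (Icc 0 T) t ∧
    ∀ᵐ x : Space, dtρ x + ∑ j, v t j x * weakDeriv j (ρ t) x
      = - ∑ j, weakDeriv j (v t j) x
  vorticity : ∀ t ∈ Icc 0 T, IsSpecificVorticity ρbar (v t) (ρ t) (ϖ t)
  sobolev_bound : ∃ C : ℝ, ∀ t ∈ Icc 0 T, (∀ i, HsNormLE s (v t i) C) ∧ HsNormLE s (ρ t) C
  velocity_strichartz : ∀ i j, normSqL2Linfty T (fun t => weakDeriv j (v t i)) < ⊤
  density_strichartz : ∀ j, normSqL2Linfty T (fun t => weakDeriv j (ρ t)) < ⊤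

end CompressibleEuler

end

open CompressibleEuler

/-! Uniqueness comes from a weighted L² energy estimate for the difference of the two solutions.
Write `c_s² = A e^{kρ}` with `A = γ ρbar^(γ-1)` and `k = γ - 1`, and let `E(t)` be the integral of
`|v - φ|² + c_s²(ρ) (ρ - ψ)²`. The weight symmetrizes the system: the time derivative of this
density plus the divergence of the flux `v e + 2 c_s² (ρ - ψ)(v - φ)`, where `e` is the density,
contains no derivative of the difference (`energy_identity`). What is left is quadratic in the
difference, with first space derivatives of the solutions as coefficients. Since `ρ` and `ψ` are
bounded, `E' ≤ C a E`, where `a(t)` is the sum of the `L^∞` norms of these derivatives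
(`exists_energy_bound`, `energy_inequality`). The function `a` is integrable because it is square
integrable on a bounded interval, so Grönwall's lemma gives `E = 0`. The specific vorticities agree
because velocity and density determine them.

Low regularity requires three supports. The flux must integrate to zero although the solutions are
only in `H^s`: they are approximated by Schwartz functions that stay bounded and converge in `H¹`
(`HsNormLE.exists_schwartzApprox`, `integral_fderiv_comp_weakDeriv`). `E` must be differentiable
although the solutions are differentiable in time only in L² (`hasDerivWithinAt_integral_comp`).
Both work because density and flux vanish to second order at the origin. Finally, the energy
inequality holds only at almost every time, but `E` is differentiable at every time, which is enough
for `eq_zero_of_deriv_le_mul`. -/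

namespace CompressibleEuler

open Filter Topology FourierTransform
open scoped LineDeriv

/-! ### Fourier multipliers with bounded or square integrable symbol. -/

section FourierMultiplier

variable {m : Space → ℂ}

/-- Plancherel, applied before and after multiplication by the symbol. -/
theorem norm_toLp_fourierMultiplierCLM_le (hm : m.HasTemperateGrowth) {C : ℝ}
    (hC : ∀ ξ, ‖m ξ‖ ≤ C) (G : 𝓢(Space, ℂ)) :
    ‖(SchwartzMap.fourierMultiplierCLM ℂ m G).toLp 2‖ ≤ C * ‖G.toLp 2‖ := by
  have h1 : ∀ F : 𝓢(Space, ℂ), ‖(𝓕⁻ F).toLp 2‖ = ‖F.toLp 2‖ := fun F => by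
    rw [← SchwartzMap.norm_fourier_toL2_eq (𝓕⁻ F)]; simp
  rw [SchwartzMap.fourierMultiplierCLM_apply, h1, ← SchwartzMap.norm_fourier_toL2_eq G]
  refine Lp.norm_le_mul_norm_of_ae_le_mul ?_
  filter_upwards [(SchwartzMap.smulLeftCLM ℂ m (𝓕 G)).coeFn_toLp 2 volume,
    (𝓕 G).coeFn_toLp 2 volume] with ξ h2 h3
  rw [h2, h3, SchwartzMap.smulLeftCLM_apply_apply hm, norm_smul]
  gcongr
  exact hC ξ

theorem toTemperedDistribution_injective {f g : Lp ℂ 2 (volume : Measure Space)}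
    (h : (f : 𝓢'(Space, ℂ)) = g) : f = g := by
  have := Lp.ker_toTemperedDistributionCLM_eq_bot (F := ℂ) (μ := (volume : Measure Space)) (p := 2)
  exact LinearMap.ker_eq_bot.mp this h

/-- A bounded symbol maps L²-Cauchy sequences to L²-Cauchy sequences. The limit is identified in the
tempered distributions, where the multiplier is continuous. -/
theorem exists_tendsto_toLp_fourierMultiplierCLM (hm : m.HasTemperateGrowth) {C : ℝ}
    (hC : ∀ ξ, ‖m ξ‖ ≤ C) {G : ℕ → 𝓢(Space, ℂ)} {g : Lp ℂ 2 (volume : Measure Space)}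
    (hG : Tendsto (fun n => (G n).toLp 2) atTop (𝓝 g)) :
    ∃ h : Lp ℂ 2 (volume : Measure Space),
      Tendsto (fun n => (SchwartzMap.fourierMultiplierCLM ℂ m (G n)).toLp 2) atTop (𝓝 h) ∧
      TemperedDistribution.fourierMultiplierCLM ℂ m (g : 𝓢'(Space, ℂ)) = h := by
  have hC0 : 0 ≤ C := (norm_nonneg _).trans (hC 0)
  have hcau : CauchySeq
      (fun n => (SchwartzMap.fourierMultiplierCLM ℂ m (G n)).toLp 2 (volume : Measure Space)) := by
    have h1 := hG.cauchySeq
    rw [Metric.cauchySeq_iff'] at h1 ⊢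
    intro ε hε
    obtain ⟨N, hN⟩ := h1 (ε / (C + 1)) (by positivity)
    refine ⟨N, fun n hn => ?_⟩
    have h2 := hN n hn
    rw [dist_eq_norm] at h2 ⊢
    have hsub : ∀ F F' : 𝓢(Space, ℂ), F.toLp 2 (volume : Measure Space) - F'.toLp 2 volume
        = (F - F').toLp 2 volume := fun F F' =>
      ((SchwartzMap.toLpCLM ℂ ℂ 2 (volume : Measure Space)).map_sub F F').symm
    rw [hsub] at h2 ⊢
    rw [← map_sub]
    calc _ ≤ C * _ := norm_toLp_fourierMultiplierCLM_le hm hC _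
      _ ≤ (C + 1) * ‖(G n - G N).toLp 2 (volume : Measure Space)‖ := by gcongr; linarith
      _ < ε := by rw [lt_div_iff₀ (by positivity)] at h2; linarith
  obtain ⟨h, hh⟩ := cauchySeq_tendsto_of_complete hcau
  refine ⟨h, hh, ?_⟩
  let T := Lp.toTemperedDistributionCLM ℂ (volume : Measure Space) 2
  have t1 : Tendsto (fun n => T ((SchwartzMap.fourierMultiplierCLM ℂ m (G n)).toLp 2)) atTop
      (𝓝 (T h)) := (T.continuous.tendsto h).comp hh
  have t2 : Tendsto (fun n => TemperedDistribution.fourierMultiplierCLM ℂ m (T ((G n).toLp 2)))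
      atTop (𝓝 (TemperedDistribution.fourierMultiplierCLM ℂ m (T g))) :=
    (((TemperedDistribution.fourierMultiplierCLM ℂ m).comp T).continuous.tendsto g).comp hG
  refine tendsto_nhds_unique t2 (t1.congr fun n => ?_)
  simp only [T, Lp.toTemperedDistributionCLM_apply, Lp.toTemperedDistribution_toLp_eq]
  exact (TemperedDistribution.fourierMultiplierCLM_toTemperedDistributionCLM_eq hm (G n)).symm

theorem norm_toLp_one_smulLeftCLM_le (hm : m.HasTemperateGrowth)
    (hm2 : MemLp m 2 (volume : Measure Space)) (F : 𝓢(Space, ℂ)) :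
    ‖(SchwartzMap.smulLeftCLM ℂ m F).toLp 1 (volume : Measure Space)‖
      ≤ ‖hm2.toLp m‖ * ‖F.toLp 2 (volume : Measure Space)‖ := by
  let M : Lp ℂ 2 (volume : Measure Space) := hm2.toLp m
  let F2 : Lp ℂ 2 (volume : Measure Space) := F.toLp 2 volume
  let P : Lp ℂ 1 (volume : Measure Space) := HSMul.hSMul M F2
  have h2 : (SchwartzMap.smulLeftCLM ℂ m F).toLp 1 (volume : Measure Space) = P := by
    refine Lp.ext ?_
    filter_upwards [(SchwartzMap.smulLeftCLM ℂ m F).coeFn_toLp 1 volume,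
      F.coeFn_toLp 2 volume, hm2.coeFn_toLp, Lp.coeFn_lpSMul (r := 1) M F2] with ξ h2 h3 h4 h5
    rw [h2, h5, SchwartzMap.smulLeftCLM_apply_apply hm, Pi.smul_apply', h3, h4]
  rw [h2]
  exact Lp.norm_smul_le M F2

/-- The mechanism of the Sobolev embedding into `L^∞`: a value of an inverse Fourier transform is at
most the L¹ norm of `m` times the transform of `G`, and Cauchy–Schwarz and Plancherel bound that
norm. -/
theorem norm_fourierMultiplierCLM_apply_le (hm : m.HasTemperateGrowth)
    (hm2 : MemLp m 2 (volume : Measure Space)) (G : 𝓢(Space, ℂ)) (x : Space) :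
    ‖SchwartzMap.fourierMultiplierCLM ℂ m G x‖
      ≤ ‖hm2.toLp m‖ * ‖G.toLp 2 (volume : Measure Space)‖ := by
  rw [SchwartzMap.fourierMultiplierCLM_apply, SchwartzMap.fourierInv_apply_eq,
    ← SchwartzMap.norm_fourier_toL2_eq G]
  refine le_trans ?_ (norm_toLp_one_smulLeftCLM_le hm hm2 _)
  have h1 := SchwartzMap.norm_fourier_apply_le_toLp_one (SchwartzMap.smulLeftCLM ℂ m (𝓕 G)) (-x)
  refine le_of_eq_of_le ?_ h1
  simp [SchwartzMap.compCLMOfContinuousLinearEquiv_apply]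

end FourierMultiplier

/-! ### Approximation of `H^s` functions by Schwartz functions. -/

/-- The `j`-th vector of the standard basis of `ℝ³`. -/
noncomputable abbrev basisVec (j : Fin 3) : Space := EuclideanSpace.single j 1

/-- The Schwartz functions `u n` are bounded by `M`, converge to `f` in `H¹` with `∂_j (u n) → g j`,
and their pure second derivatives are bounded by `M` in `L²`. -/
structure SchwartzApprox (M : ℝ) (f : L2) (g : Fin 3 → L2) (u : ℕ → 𝓢(Space, ℝ)) : Prop where
  bound : ∀ n x, |u n x| ≤ M
  tendsto : Tendsto (fun n => (u n).toLp 2 (volume : Measure Space)) atTop (𝓝 f)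
  tendsto_deriv : ∀ j,
    Tendsto (fun n => (∂_{basisVec j} (u n)).toLp 2 (volume : Measure Space)) atTop (𝓝 (g j))
  norm_second_deriv : ∀ j n,
    ‖(∂_{basisVec j} (∂_{basisVec j} (u n))).toLp 2 (volume : Measure Space)‖ ≤ M

section RealPart

/-- The real part of a Schwartz function. -/
noncomputable def reSchwartz : 𝓢(Space, ℂ) →L[ℝ] 𝓢(Space, ℝ) :=
  SchwartzMap.postcompCLM Complex.reCLM

theorem reSchwartz_apply (F : 𝓢(Space, ℂ)) (x : Space) : reSchwartz F x = (F x).re := rfl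

theorem lineDerivOp_reSchwartz (m : Space) (F : 𝓢(Space, ℂ)) :
    ∂_{m} (reSchwartz F) = reSchwartz (∂_{m} F) := by
  ext x
  rw [SchwartzMap.lineDerivOp_apply_eq_fderiv, reSchwartz_apply,
    SchwartzMap.lineDerivOp_apply_eq_fderiv]
  have h := Complex.reCLM.hasFDerivAt.comp x (F.hasFDerivAt x)
  exact congrArg (fun A : Space →L[ℝ] ℝ => A m) h.fderiv

theorem toLp_reSchwartz (F : 𝓢(Space, ℂ)) :
    (reSchwartz F).toLp 2 (volume : Measure Space)
      = Complex.reCLM.compLpL 2 volume (F.toLp 2 volume) := by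
  refine Lp.ext ?_
  filter_upwards [(reSchwartz F).coeFn_toLp 2 volume, F.coeFn_toLp 2 volume,
    Complex.reCLM.coeFn_compLpL (F.toLp 2 (volume : Measure Space))] with x h1 h2 h3
  rw [h1, h3, h2]; rfl

theorem norm_toLp_reSchwartz_le (F : 𝓢(Space, ℂ)) :
    ‖(reSchwartz F).toLp 2 (volume : Measure Space)‖ ≤ ‖F.toLp 2 (volume : Measure Space)‖ := by
  refine Lp.norm_le_norm_of_ae_le ?_
  filter_upwards [(reSchwartz F).coeFn_toLp 2 volume, F.coeFn_toLp 2 volume] with x h1 h2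
  rw [h1, h2]
  exact Complex.abs_re_le_norm _

theorem re_complexify (f : L2) : Complex.reCLM.compLpL 2 volume (complexify f) = f := by
  refine Lp.ext ?_
  filter_upwards [Complex.reCLM.coeFn_compLpL (complexify f),
    Complex.ofRealCLM.coeFn_compLp f] with x h1 h2
  rw [h1, complexify, h2]; simp

end RealPart

section Bessel

/-- The symbol `(1 + |ξ|²)^(-s/2)`. -/
noncomputable def besselSymbol (s : ℝ) (ξ : Space) : ℂ := ((1 + ‖ξ‖ ^ 2) ^ (-s / 2) : ℝ)

/-- The symbol `ξ_j`. -/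
noncomputable def coordSymbol (j : Fin 3) (ξ : Space) : ℂ := (inner ℝ ξ (basisVec j) : ℝ)

theorem hasTemperateGrowth_besselSymbol (s : ℝ) : (besselSymbol s).HasTemperateGrowth := by
  unfold besselSymbol; fun_prop

theorem hasTemperateGrowth_coordSymbol (j : Fin 3) : (coordSymbol j).HasTemperateGrowth := by
  unfold coordSymbol; fun_prop

theorem norm_besselSymbol_le {s : ℝ} (hs : 2 ≤ s) (ξ : Space) :
    ‖besselSymbol s ξ‖ ≤ (1 + ‖ξ‖ ^ 2)⁻¹ := by
  rw [besselSymbol, Complex.norm_real, Real.norm_of_nonneg (by positivity),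
    ← Real.rpow_neg_one]
  exact Real.rpow_le_rpow_of_exponent_le (by nlinarith [norm_nonneg ξ]) (by linarith)

theorem norm_coordSymbol_le (j : Fin 3) (ξ : Space) : ‖coordSymbol j ξ‖ ≤ ‖ξ‖ := by
  rw [coordSymbol, Complex.norm_real]
  refine (norm_inner_le_norm _ _).trans ?_
  simp

theorem norm_besselSymbol_le_one {s : ℝ} (hs : 2 ≤ s) (ξ : Space) : ‖besselSymbol s ξ‖ ≤ 1 :=
  (norm_besselSymbol_le hs ξ).trans (inv_le_one_of_one_le₀ (by nlinarith [norm_nonneg ξ]))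

theorem norm_coordSymbol_mul_besselSymbol_le_one {s : ℝ} (hs : 2 ≤ s) (j : Fin 3) (ξ : Space) :
    ‖(coordSymbol j * besselSymbol s) ξ‖ ≤ 1 := by
  rw [Pi.mul_apply, norm_mul]
  calc _ ≤ ‖ξ‖ * (1 + ‖ξ‖ ^ 2)⁻¹ := by
        gcongr
        exacts [norm_coordSymbol_le j ξ, norm_besselSymbol_le hs ξ]
    _ ≤ 1 := by
        rw [mul_inv_le_iff₀ (by positivity)]; nlinarith [sq_nonneg (‖ξ‖ - 1)]

theorem norm_coordSymbol_sq_mul_besselSymbol_le_one {s : ℝ} (hs : 2 ≤ s) (j : Fin 3) (ξ : Space) :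
    ‖(coordSymbol j * (coordSymbol j * besselSymbol s)) ξ‖ ≤ 1 := by
  rw [Pi.mul_apply, Pi.mul_apply, norm_mul, norm_mul]
  calc _ ≤ ‖ξ‖ * (‖ξ‖ * (1 + ‖ξ‖ ^ 2)⁻¹) := by
        gcongr
        exacts [norm_coordSymbol_le j ξ, norm_coordSymbol_le j ξ, norm_besselSymbol_le hs ξ]
    _ ≤ 1 := by
        rw [← mul_assoc, mul_inv_le_iff₀ (by positivity)]; nlinarith [norm_nonneg ξ]

/-- The squared symbol `(1 + |ξ|²)^(-s)` is integrable on `ℝ³` because `2s > 3`. -/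
theorem memLp_besselSymbol {s : ℝ} (hs : 2 ≤ s) :
    MemLp (besselSymbol s) 2 (volume : Measure Space) := by
  rw [memLp_two_iff_integrable_sq_norm
    (hasTemperateGrowth_besselSymbol s).1.continuous.aestronglyMeasurable]
  have h : (Module.finrank ℝ Space : ℝ) < 2 * s := by simp; linarith
  refine (integrable_rpow_neg_one_add_norm_sq (μ := (volume : Measure Space)) h).congr ?_
  refine .of_forall fun ξ => ?_
  simp only [besselSymbol]
  rw [Complex.norm_real, Real.norm_of_nonneg (by positivity),
    ← Real.rpow_mul_natCast (by positivity)]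
  congr 1
  push_cast; ring

/-- Reduces bounds on derivatives to bounds on the symbols `ξ_j m` and `ξ_j² m`. -/
theorem lineDerivOp_fourierMultiplierCLM {m : Space → ℂ} (hm : m.HasTemperateGrowth) (j : Fin 3)
    (G : 𝓢(Space, ℂ)) :
    ∂_{basisVec j} (SchwartzMap.fourierMultiplierCLM ℂ m G)
      = (2 * Real.pi * Complex.I) • SchwartzMap.fourierMultiplierCLM ℂ (coordSymbol j * m) G := by
  rw [SchwartzMap.lineDeriv_eq_fourierMultiplierCLM,
    ← SchwartzMap.fourierMultiplierCLM_ofReal ℂ (by fun_prop),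
    ← SchwartzMap.fourierMultiplierCLM_fourierMultiplierCLM_apply
      (hasTemperateGrowth_coordSymbol j) hm]
  rfl

theorem toLp_smul (c : ℂ) (F : 𝓢(Space, ℂ)) :
    (c • F).toLp 2 (volume : Measure Space) = c • F.toLp 2 volume :=
  (SchwartzMap.toLpCLM ℂ ℂ 2 (volume : Measure Space)).map_smul c F

/-- Functions in `H^s(ℝ³)`, `s ≥ 2`, are limits in `H¹` of Schwartz functions that are bounded in
`L^∞` and in `H²`. -/
theorem HsNormLE.exists_schwartzApprox {s : ℝ} (hs : 2 ≤ s) :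
    ∃ K : ℝ, 0 ≤ K ∧ ∀ (f : L2) (C : ℝ), HsNormLE s f C →
      ∃ (g : Fin 3 → L2) (u : ℕ → 𝓢(Space, ℝ)), SchwartzApprox (K * (C + 1)) f g u := by
  have hb := hasTemperateGrowth_besselSymbol s
  -- `K₀` comes from the sup bound; `K₁ = |2πi|²` comes from the two factors `2πi` of a second
  -- derivative.
  let K₀ := ‖(memLp_besselSymbol hs).toLp (besselSymbol s)‖
  let K₁ := ‖(2 * Real.pi * Complex.I : ℂ)‖ ^ 2
  refine ⟨K₀ + K₁, by positivity, fun f C ⟨w, hw, hwC⟩ => ?_⟩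
  have hC : 0 ≤ C := (norm_nonneg _).trans hwC
  obtain ⟨x, hx, hxw⟩ := mem_closure_iff_seq_limit.mp
    (SchwartzMap.denseRange_toLpCLM (E := Space) (F := ℂ) (p := 2) (μ := volume)
      ENNReal.ofNat_ne_top w)
  choose G₀ hG₀ using hx
  have hG₁ : Tendsto (fun n => (G₀ n).toLp 2 (volume : Measure Space)) atTop (𝓝 w) := by
    refine hxw.congr fun n => ?_
    rw [← hG₀ n]; rfl
  -- Dropping the first `N` terms makes the norm bound `C + 1` hold for every index.
  obtain ⟨N, hN⟩ := eventually_atTop.mp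
    (hG₁.norm.eventually_lt_const (show ‖w‖ < C + 1 by linarith))
  let G : ℕ → 𝓢(Space, ℂ) := fun n => G₀ (n + N)
  have hG : Tendsto (fun n => (G n).toLp 2 (volume : Measure Space)) atTop (𝓝 w) :=
    hG₁.comp (tendsto_add_atTop_nat N)
  have hGC : ∀ n, ‖(G n).toLp 2 (volume : Measure Space)‖ ≤ C + 1 := fun n =>
    (hN (n + N) (by omega)).le
  obtain ⟨h₀, hh₀, hf⟩ :=
    exists_tendsto_toLp_fourierMultiplierCLM hb (norm_besselSymbol_le_one hs) hG
  -- Applying the Bessel potential of order `-s` to `w`, the potential of order `s` of `f`, recovers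
  -- `f`.
  have hfh : complexify f = h₀ := by
    refine toTemperedDistribution_injective ?_
    rw [← hf, ← hw]
    exact (TemperedDistribution.besselPotential_neg_apply_eq_iff s _ _).mpr rfl |>.symm
  have hd := fun j => exists_tendsto_toLp_fourierMultiplierCLM
    ((hasTemperateGrowth_coordSymbol j).mul hb) (norm_coordSymbol_mul_besselSymbol_le_one hs j) hG
  choose h₁ hh₁ _ using hd
  let F : ℕ → 𝓢(Space, ℂ) := fun n => SchwartzMap.fourierMultiplierCLM ℂ (besselSymbol s) (G n)
  refine ⟨fun j => Complex.reCLM.compLpL 2 volume ((2 * Real.pi * Complex.I : ℂ) • h₁ j),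
    fun n => reSchwartz (F n), ?_, ?_, ?_, ?_⟩
  · intro n x
    calc |reSchwartz (F n) x| ≤ ‖F n x‖ := Complex.abs_re_le_norm _
      _ ≤ K₀ * ‖(G n).toLp 2 (volume : Measure Space)‖ :=
        norm_fourierMultiplierCLM_apply_le hb (memLp_besselSymbol hs) (G n) x
      _ ≤ (K₀ + K₁) * (C + 1) := by
        gcongr
        · exact le_add_of_nonneg_right (by positivity)
        · exact hGC n
  · rw [← re_complexify f, hfh]
    simp_rw [toLp_reSchwartz]
    exact ((Complex.reCLM.compLpL 2 (volume : Measure Space)).continuous.tendsto _).comp hh₀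
  · intro j
    simp_rw [lineDerivOp_reSchwartz, toLp_reSchwartz, F, lineDerivOp_fourierMultiplierCLM hb,
      toLp_smul]
    exact ((Complex.reCLM.compLpL 2 (volume : Measure Space)).continuous.tendsto _).comp
      ((hh₁ j).const_smul _)
  · intro j n
    simp_rw [lineDerivOp_reSchwartz]
    refine (norm_toLp_reSchwartz_le _).trans ?_
    simp_rw [F, lineDerivOp_fourierMultiplierCLM hb]
    rw [LineDeriv.lineDerivOp_smul, lineDerivOp_fourierMultiplierCLM
      ((hasTemperateGrowth_coordSymbol j).mul hb), toLp_smul, toLp_smul, norm_smul, norm_smul,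
      ← mul_assoc, ← sq]
    calc _ ≤ K₁ * (1 * ‖(G n).toLp 2 (volume : Measure Space)‖) := by
          gcongr
          exact norm_toLp_fourierMultiplierCLM_le
            ((hasTemperateGrowth_coordSymbol j).mul ((hasTemperateGrowth_coordSymbol j).mul hb))
            (norm_coordSymbol_sq_mul_besselSymbol_le_one hs j) (G n)
      _ ≤ (K₀ + K₁) * (C + 1) := by
          rw [one_mul]
          gcongr
          · exact le_add_of_nonneg_left (by positivity)
          · exact hGC n

end Bessel

/-! ### Weak derivatives and limits in L². -/

theorem inner_eq_integral_mul (f g : L2) : inner ℝ f g = ∫ x, f x * g x := by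
  rw [L2.inner_def]
  exact integral_congr_ae (.of_forall fun x => by simp [mul_comm])

theorem inner_toLp_eq_integral_mul (u w : 𝓢(Space, ℝ)) :
    inner ℝ (u.toLp 2 (volume : Measure Space)) (w.toLp 2 volume) = ∫ x, u x * w x := by
  rw [inner_eq_integral_mul]
  refine integral_congr_ae ?_
  filter_upwards [u.coeFn_toLp 2 volume, w.coeFn_toLp 2 volume] with x h1 h2
  rw [h1, h2]

theorem inner_toLp_lineDerivOp (u w : 𝓢(Space, ℝ)) (m : Space) :
    inner ℝ (u.toLp 2 (volume : Measure Space)) ((∂_{m} w).toLp 2 volume)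
      = - inner ℝ ((∂_{m} u).toLp 2 (volume : Measure Space)) (w.toLp 2 volume) := by
  rw [inner_toLp_eq_integral_mul, inner_toLp_eq_integral_mul]
  exact SchwartzMap.integral_mul_lineDerivOp_right_eq_neg_left u w m

/-- In this form the condition visibly passes to L² limits. -/
theorem isWeakDeriv_iff_inner {j : Fin 3} {f g : L2} :
    IsWeakDeriv j f g ↔ ∀ (φ : Space → ℝ) (h₁ : ContDiff ℝ ∞ φ) (h₂ : HasCompactSupport φ),
      inner ℝ f ((∂_{basisVec j} (h₂.toSchwartzMap h₁)).toLp 2 (volume : Measure Space))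
        = - inner ℝ g ((h₂.toSchwartzMap h₁).toLp 2 (volume : Measure Space)) := by
  refine forall_congr' fun φ => forall_congr' fun h₁ => forall_congr' fun h₂ => ?_
  have e1 : inner ℝ f ((∂_{basisVec j} (h₂.toSchwartzMap h₁)).toLp 2 (volume : Measure Space))
      = ∫ x, f x * fderiv ℝ φ x (EuclideanSpace.single j 1) := by
    rw [inner_eq_integral_mul]
    refine integral_congr_ae ?_
    filter_upwards [(∂_{basisVec j} (h₂.toSchwartzMap h₁)).coeFn_toLp 2 volume] with x h
    rw [h, SchwartzMap.lineDerivOp_apply_eq_fderiv]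
    rfl
  have e2 : inner ℝ g ((h₂.toSchwartzMap h₁).toLp 2 (volume : Measure Space))
      = ∫ x, g x * φ x := by
    rw [inner_eq_integral_mul]
    refine integral_congr_ae ?_
    filter_upwards [(h₂.toSchwartzMap h₁).coeFn_toLp 2 volume] with x h
    rw [h]
    rfl
  rw [e1, e2]

theorem IsWeakDeriv.unique {j : Fin 3} {f g g' : L2} (h : IsWeakDeriv j f g)
    (h' : IsWeakDeriv j f g') : g = g' := by
  rw [← sub_eq_zero, Lp.eq_zero_iff_ae_eq_zero]
  refine ae_eq_zero_of_integral_contDiff_smul_eq_zero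
    ((Lp.memLp (g - g')).locallyIntegrable (by norm_num)) fun φ h₁ h₂ => ?_
  have e := (isWeakDeriv_iff_inner.mp h φ h₁ h₂).symm.trans (isWeakDeriv_iff_inner.mp h' φ h₁ h₂)
  have e2 : inner ℝ (g - g') ((h₂.toSchwartzMap h₁).toLp 2 (volume : Measure Space)) = 0 := by
    rw [inner_sub_left]; linarith
  rw [← e2, inner_eq_integral_mul]
  refine integral_congr_ae ?_
  filter_upwards [(h₂.toSchwartzMap h₁).coeFn_toLp 2 volume] with x h
  rw [h, smul_eq_mul, mul_comm]
  rfl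

theorem IsWeakDeriv.weakDeriv_eq {j : Fin 3} {f g : L2} (h : IsWeakDeriv j f g) :
    weakDeriv j f = g := by
  have hex : ∃ g, IsWeakDeriv j f g := ⟨g, h⟩
  rw [weakDeriv, dif_pos hex]
  exact hex.choose_spec.unique h

/-- The `L^∞` norm is lower semicontinuous on `L²`. -/
theorem lowerSemicontinuous_eLpNorm_top :
    LowerSemicontinuous fun f : L2 => eLpNorm f ⊤ (volume : Measure Space) := by
  rw [lowerSemicontinuous_iff_isClosed_preimage]
  intro c
  refine IsSeqClosed.isClosed fun w f hw hf => ?_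
  -- Sublevel sets are closed: an L² limit is an almost everywhere limit along a subsequence, and
  -- pointwise bounds survive.
  obtain ⟨ns, -, hae⟩ := (tendstoInMeasure_of_tendsto_Lp hf).exists_seq_tendsto_ae
  have hbd : ∀ᵐ x, ∀ n, ‖w n x‖ₑ ≤ c := ae_all_iff.mpr fun n => by
    have h1 : eLpNorm (w n) ⊤ volume ≤ c := hw n
    rw [eLpNorm_exponent_top] at h1
    filter_upwards [enorm_ae_le_eLpNormEssSup (w n) volume] with x hx
    exact hx.trans h1
  change eLpNorm f ⊤ volume ≤ c
  rw [eLpNorm_exponent_top]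
  refine eLpNormEssSup_le_of_ae_enorm_bound ?_
  filter_upwards [hae, hbd] with x h1 h2
  exact le_of_tendsto h1.enorm (.of_forall fun i => h2 (ns i))

theorem ae_abs_le_of_tendsto {M : ℝ} {w : ℕ → L2} {f : L2} (hf : Tendsto w atTop (𝓝 f))
    (hw : ∀ n, ∀ᵐ x, |w n x| ≤ M) : ∀ᵐ x, |f x| ≤ M := by
  obtain ⟨ns, -, hae⟩ := (tendstoInMeasure_of_tendsto_Lp hf).exists_seq_tendsto_ae
  filter_upwards [hae, ae_all_iff.mpr hw] with x h1 h2
  exact le_of_tendsto h1.abs (.of_forall fun i => h2 (ns i))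

theorem toLp_sub_schwartz (u w : 𝓢(Space, ℝ)) :
    (u - w).toLp 2 (volume : Measure Space) = u.toLp 2 volume - w.toLp 2 volume :=
  (SchwartzMap.toLpCLM ℝ ℝ 2 (volume : Measure Space)).map_sub u w

theorem lineDerivOp_sub_schwartz (m : Space) (u w : 𝓢(Space, ℝ)) :
    ∂_{m} (u - w) = ∂_{m} u - ∂_{m} w :=
  (LineDeriv.lineDerivOpCLM ℝ 𝓢(Space, ℝ) m).map_sub u w

namespace SchwartzApprox

variable {M M' : ℝ} {f f' : L2} {g g' : Fin 3 → L2} {u u' : ℕ → 𝓢(Space, ℝ)}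

theorem isWeakDeriv (h : SchwartzApprox M f g u) (j : Fin 3) : IsWeakDeriv j f (g j) := by
  rw [isWeakDeriv_iff_inner]
  intro φ h₁ h₂
  refine tendsto_nhds_unique (h.tendsto.inner tendsto_const_nhds) ?_
  exact (((h.tendsto_deriv j).inner tendsto_const_nhds).neg).congr fun n =>
    (inner_toLp_lineDerivOp _ _ _).symm

theorem weakDeriv_eq (h : SchwartzApprox M f g u) (j : Fin 3) : weakDeriv j f = g j :=
  (h.isWeakDeriv j).weakDeriv_eq

theorem ae_abs_le (h : SchwartzApprox M f g u) : ∀ᵐ x, |f x| ≤ M :=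
  ae_abs_le_of_tendsto h.tendsto fun n => by
    filter_upwards [(u n).coeFn_toLp 2 volume] with x hx
    rw [hx]; exact h.bound n x

theorem sub (h : SchwartzApprox M f g u) (h' : SchwartzApprox M' f' g' u') :
    SchwartzApprox (M + M') (f - f') (fun j => g j - g' j) (fun n => u n - u' n) where
  bound n x := (abs_sub _ _).trans (add_le_add (h.bound n x) (h'.bound n x))
  tendsto := by
    simp_rw [toLp_sub_schwartz]; exact h.tendsto.sub h'.tendsto
  tendsto_deriv j := by
    simp_rw [lineDerivOp_sub_schwartz, toLp_sub_schwartz]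
    exact (h.tendsto_deriv j).sub (h'.tendsto_deriv j)
  norm_second_deriv j n := by
    simp_rw [lineDerivOp_sub_schwartz, toLp_sub_schwartz]
    exact (norm_sub_le _ _).trans (add_le_add (h.norm_second_deriv j n) (h'.norm_second_deriv j n))

/-- Interpolation between L² and `H²`: integration by parts gives `‖∂_j u‖² = -⟨u, ∂_j² u⟩` for the
approximants. Applied to differences, it yields continuity in time of the weak derivatives. -/
theorem norm_deriv_sq_le (h : SchwartzApprox M f g u) (j : Fin 3) : ‖g j‖ ^ 2 ≤ ‖f‖ * M := by
  refine le_of_tendsto_of_tendsto' ((h.tendsto_deriv j).norm.pow 2)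
    (h.tendsto.norm.mul_const M) fun n => ?_
  rw [← real_inner_self_eq_norm_sq, ← neg_neg (inner ℝ _ _), ← inner_toLp_lineDerivOp]
  refine (neg_le_abs _).trans ((abs_real_inner_le_norm _ _).trans ?_)
  gcongr
  exact h.norm_second_deriv j n

end SchwartzApprox

theorem HsNormLE.exists_schwartzApprox_weakDeriv {s : ℝ} (hs : 2 ≤ s) :
    ∃ K : ℝ, 0 ≤ K ∧ ∀ (f : L2) (C : ℝ), HsNormLE s f C →
      ∃ u : ℕ → 𝓢(Space, ℝ), SchwartzApprox (K * (C + 1)) f (fun j => weakDeriv j f) u := by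
  obtain ⟨K, hK, h⟩ := HsNormLE.exists_schwartzApprox hs
  refine ⟨K, hK, fun f C hf => ?_⟩
  obtain ⟨g, u, hu⟩ := h f C hf
  rw [← funext hu.weakDeriv_eq] at hu
  exact ⟨u, hu⟩

/-! ### Integrals of nonlinear functions of bounded L² families. -/

section Superposition

variable {ι : Type*} [Fintype ι]

/-- `P` vanishes to second order at the origin, and `L` is a Lipschitz constant of its derivative
on the ball of radius `K`. -/
structure QuadraticOn (P : (ι → ℝ) → ℝ) (K L : ℝ) : Prop where
  contDiff : ContDiff ℝ 1 P
  zero : P 0 = 0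
  fderiv_zero : fderiv ℝ P 0 = 0
  nonneg_radius : 0 ≤ K
  nonneg : 0 ≤ L
  lipschitz : ∀ a b, ‖a‖ ≤ K → ‖b‖ ≤ K → ‖fderiv ℝ P a - fderiv ℝ P b‖ ≤ L * ‖a - b‖
  taylor : ∀ a b, ‖a‖ ≤ K → ‖b‖ ≤ K → |P b - P a - fderiv ℝ P a (b - a)| ≤ L * ‖b - a‖ ^ 2

theorem exists_quadraticOn {P : (ι → ℝ) → ℝ} (hP : ContDiff ℝ 2 P) (h0 : P 0 = 0)
    (h1 : fderiv ℝ P 0 = 0) {K : ℝ} (hK : 0 ≤ K) : ∃ L, QuadraticOn P K L := by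
  have hd : ContDiff ℝ 1 (fderiv ℝ P) := hP.fderiv_right (by norm_num)
  have hP1 : ContDiff ℝ 1 P := hP.of_le (by norm_num)
  have hPd : Differentiable ℝ P := hP1.differentiable (by norm_num)
  obtain ⟨L, hL⟩ := (isCompact_closedBall (0 : ι → ℝ) K).exists_bound_of_continuousOn
    (hd.continuous_fderiv (by norm_num)).continuousOn
  have hL0 : 0 ≤ L := (norm_nonneg _).trans (hL 0 (by simpa using hK))
  have hlip : ∀ a b : ι → ℝ, ‖a‖ ≤ K → ‖b‖ ≤ K →
      ‖fderiv ℝ P a - fderiv ℝ P b‖ ≤ L * ‖a - b‖ := fun a b ha hb =>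
    (convex_closedBall (0 : ι → ℝ) K).norm_image_sub_le_of_norm_fderiv_le
      (fun x _ => hd.differentiable (by norm_num) x) hL (by simpa using hb) (by simpa using ha)
  refine ⟨L, hP1, h0, h1, hK, hL0, hlip, fun a b ha hb => ?_⟩
  have hseg : ∀ x ∈ segment ℝ a b, ‖x‖ ≤ K ∧ ‖x - a‖ ≤ ‖b - a‖ := fun x hx => by
    have hxK := (convex_closedBall (0 : ι → ℝ) K).segment_subset
      (by simpa using ha) (by simpa using hb) hx
    refine ⟨by simpa using hxK, ?_⟩
    obtain ⟨θ, ⟨h0, h1⟩, rfl⟩ := (segment_eq_image' ℝ a b) ▸ hx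
    simp only [add_sub_cancel_left, norm_smul, Real.norm_of_nonneg h0]
    exact mul_le_of_le_one_left (norm_nonneg _) h1
  -- On the segment the derivative differs from its value at `a` by at most `L ‖b - a‖`, so the mean
  -- value inequality gives the quadratic remainder.
  have := (convex_segment a b).norm_image_sub_le_of_norm_fderiv_le' (φ := fderiv ℝ P a)
    (C := L * ‖b - a‖) (fun x _ => hPd x) (fun x hx => (hlip x a (hseg x hx).1 ha).trans
      (by gcongr; exact (hseg x hx).2)) (left_mem_segment ℝ a b) (right_mem_segment ℝ a b)
  rw [sq, ← mul_assoc]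
  exact this

/-- The values at `x` of a family of functions. -/
noncomputable def valueAt (U : ι → L2) (x : Space) : ι → ℝ := fun k => U k x

theorem norm_le_sum_abs (a : ι → ℝ) : ‖a‖ ≤ ∑ k, |a k| :=
  (pi_norm_le_iff_of_nonneg (Finset.sum_nonneg fun _ _ => abs_nonneg _)).mpr fun k =>
    Finset.single_le_sum (f := fun k => |a k|) (fun _ _ => abs_nonneg _) (Finset.mem_univ k)

/-- The sum of the absolute values of a family of functions. -/
noncomputable def sumAbs (U : ι → L2) : L2 := ∑ k, |U k|

theorem coeFn_sumAbs (U : ι → L2) : ∀ᵐ x, sumAbs U x = ∑ k, |U k x| := by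
  filter_upwards [Lp.coeFn_fun_finsetSum Finset.univ (fun k => |U k|),
    ae_all_iff.mpr fun k => Lp.coeFn_abs (U k)] with x h1 h2
  rw [sumAbs, h1]
  exact Finset.sum_congr rfl fun k _ => h2 k

theorem norm_sumAbs_le (U : ι → L2) : ‖sumAbs U‖ ≤ ∑ k, ‖U k‖ :=
  (norm_sum_le _ _).trans (Finset.sum_le_sum fun k _ => (norm_abs_eq_norm (U k)).le)

theorem norm_valueAt_le_sumAbs (U : ι → L2) : ∀ᵐ x, ‖valueAt U x‖ ≤ sumAbs U x := by
  filter_upwards [coeFn_sumAbs U] with x hx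
  rw [hx]; exact norm_le_sum_abs _

theorem valueAt_sub (U W : ι → L2) :
    ∀ᵐ x, valueAt (fun k => U k - W k) x = valueAt U x - valueAt W x := by
  filter_upwards [ae_all_iff.mpr fun k => Lp.coeFn_sub (U k) (W k)] with x hx
  funext k
  exact hx k

theorem aestronglyMeasurable_valueAt (U : ι → L2) :
    AEStronglyMeasurable (valueAt U) (volume : Measure Space) :=
  AEMeasurable.aestronglyMeasurable <|
    aemeasurable_pi_lambda _ fun k => (Lp.aestronglyMeasurable (U k)).aemeasurable

/-- The family `U` is bounded by `K`. -/
def BoundedBy (K : ℝ) (U : ι → L2) : Prop := ∀ᵐ x : Space, ‖valueAt U x‖ ≤ K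

theorem boundedBy_of_forall {K : ℝ} (hK : 0 ≤ K) {U : ι → L2} (h : ∀ k, ∀ᵐ x : Space, |U k x| ≤ K) :
    BoundedBy K U := by
  filter_upwards [ae_all_iff.mpr h] with x hx
  exact (pi_norm_le_iff_of_nonneg hK).mpr hx

open Classical in
/-- The function `x ↦ ∂_k P (U x)`, for `U` bounded and `P` vanishing to second order. -/
noncomputable def partialComp (P : (ι → ℝ) → ℝ) (k : ι) (U : ι → L2) : L2 :=
  if h : MemLp (fun x => fderiv ℝ P (valueAt U x) (Pi.single k 1)) 2 (volume : Measure Space)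
  then h.toLp else 0

section

variable {P : (ι → ℝ) → ℝ} {K L : ℝ} {U W : ι → L2}

open Classical in
theorem fderiv_apply_eq_sum (P : (ι → ℝ) → ℝ) (a y : ι → ℝ) :
    fderiv ℝ P a y = ∑ k, fderiv ℝ P a (Pi.single k 1) * y k := by
  conv_lhs => rw [← Finset.univ_sum_single y, map_sum]
  refine Finset.sum_congr rfl fun k _ => ?_
  rw [show Pi.single k (y k) = y k • (Pi.single k 1 : ι → ℝ) by
    rw [← Pi.single_smul]; simp, map_smul, smul_eq_mul, mul_comm]

-- Since `fderiv ℝ P` vanishes at the origin and is `L`-Lipschitz on the ball, the composite is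
-- dominated by `L` times `sumAbs U`. It is therefore in L², and the default value of `partialComp`
-- is not taken.
open Classical in
theorem coeFn_partialComp (hP : QuadraticOn P K L) (hU : BoundedBy K U) (k : ι) :
    ∀ᵐ x, partialComp P k U x = fderiv ℝ P (valueAt U x) (Pi.single k 1) := by
  have h : MemLp (fun x => fderiv ℝ P (valueAt U x) (Pi.single k 1)) 2
      (volume : Measure Space) := by
    refine (Lp.memLp (sumAbs U)).of_le_mul (c := L) ?_ ?_
    · exact ((hP.contDiff.continuous_fderiv (by norm_num)).clm_apply
        continuous_const).comp_aestronglyMeasurable (aestronglyMeasurable_valueAt U)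
    · filter_upwards [hU, norm_valueAt_le_sumAbs U] with x h1 h2
      have h3 := hP.lipschitz _ 0 h1 (by simpa using hP.nonneg_radius)
      rw [hP.fderiv_zero, sub_zero, sub_zero] at h3
      calc _ ≤ ‖fderiv ℝ P (valueAt U x)‖ * ‖(Pi.single k 1 : ι → ℝ)‖ :=
            ContinuousLinearMap.le_opNorm _ _
        _ = ‖fderiv ℝ P (valueAt U x)‖ := by rw [Pi.norm_single]; simp
        _ ≤ L * ‖valueAt U x‖ := h3
        _ ≤ L * ‖sumAbs U x‖ := by
          have := hP.nonneg
          gcongr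
          exact h2.trans (le_abs_self _)
  rw [partialComp, dif_pos h]
  exact h.coeFn_toLp

open Classical in
theorem norm_partialComp_sub_le (hP : QuadraticOn P K L) (hU : BoundedBy K U)
    (hW : BoundedBy K W) (k : ι) :
    ‖partialComp P k U - partialComp P k W‖ ≤ L * ∑ k, ‖U k - W k‖ := by
  have hL := hP.nonneg
  calc _ ≤ L * ‖sumAbs fun k => U k - W k‖ := by
        refine Lp.norm_le_mul_norm_of_ae_le_mul ?_
        filter_upwards [hU, hW, coeFn_partialComp hP hU k, coeFn_partialComp hP hW k,
          Lp.coeFn_sub (partialComp P k U) (partialComp P k W), valueAt_sub U W,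
          norm_valueAt_le_sumAbs fun k => U k - W k] with x h1 h2 h3 h4 h5 h6 h7
        rw [h5, Pi.sub_apply, h3, h4, ← sub_apply]
        calc _ ≤ ‖fderiv ℝ P (valueAt U x) - fderiv ℝ P (valueAt W x)‖
              * ‖(Pi.single k 1 : ι → ℝ)‖ := ContinuousLinearMap.le_opNorm _ _
          _ = ‖fderiv ℝ P (valueAt U x) - fderiv ℝ P (valueAt W x)‖ := by
            rw [Pi.norm_single]; simp
          _ ≤ L * ‖valueAt U x - valueAt W x‖ := hP.lipschitz _ _ h1 h2
          _ ≤ _ := by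
            rw [← h6]
            gcongr
            exact h7.trans (le_abs_self _)
    _ ≤ _ := by gcongr; exact norm_sumAbs_le _

theorem tendsto_partialComp (hP : QuadraticOn P K L) {w : ℕ → ι → L2}
    (hw : ∀ n, BoundedBy K (w n)) (hU : BoundedBy K U)
    (h : ∀ k, Tendsto (fun n => w n k) atTop (𝓝 (U k))) (k : ι) :
    Tendsto (fun n => partialComp P k (w n)) atTop (𝓝 (partialComp P k U)) := by
  rw [tendsto_iff_norm_sub_tendsto_zero]
  refine squeeze_zero (fun _ => norm_nonneg _)
    (fun n => norm_partialComp_sub_le hP (hw n) hU k) ?_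
  have h1 : Tendsto (fun n => ∑ k, ‖w n k - U k‖) atTop (𝓝 (∑ _k : ι, 0)) :=
    tendsto_finsetSum _ fun k _ => tendsto_iff_norm_sub_tendsto_zero.mp (h k)
  simpa using h1.const_mul L

theorem integrable_mul (f g : L2) : Integrable (fun x => f x * g x) (volume : Measure Space) :=
  (Lp.memLp f).integrable_mul (Lp.memLp g)

theorem ae_fderiv_valueAt_apply (hP : QuadraticOn P K L) (hU : BoundedBy K U) (Y : ι → L2) :
    ∀ᵐ x, fderiv ℝ P (valueAt U x) (valueAt Y x) = ∑ k, partialComp P k U x * Y k x := by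
  classical
  filter_upwards [ae_all_iff.mpr fun k => coeFn_partialComp hP hU k] with x hx
  rw [fderiv_apply_eq_sum]
  refine Finset.sum_congr rfl fun k _ => ?_
  rw [hx k]
  rfl

theorem integrable_fderiv_valueAt_apply (hP : QuadraticOn P K L) (hU : BoundedBy K U)
    (Y : ι → L2) :
    Integrable (fun x => fderiv ℝ P (valueAt U x) (valueAt Y x)) (volume : Measure Space) := by
  refine Integrable.congr ?_ ((ae_fderiv_valueAt_apply hP hU Y).mono fun x hx => hx.symm)
  exact integrable_finsetSum _ fun k _ => integrable_mul _ _

theorem integral_fderiv_valueAt_apply (hP : QuadraticOn P K L) (hU : BoundedBy K U)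
    (Y : ι → L2) :
    ∫ x, fderiv ℝ P (valueAt U x) (valueAt Y x) = ∑ k, inner ℝ (partialComp P k U) (Y k) := by
  rw [integral_congr_ae (ae_fderiv_valueAt_apply hP hU Y),
    integral_finsetSum _ fun k _ => integrable_mul _ _]
  exact Finset.sum_congr rfl fun k _ => (inner_eq_integral_mul _ _).symm

end

end Superposition

section

variable {ι : Type*} [Fintype ι] {P : (ι → ℝ) → ℝ} {K L : ℝ} {U W : ι → L2}

theorem QuadraticOn.abs_le (hP : QuadraticOn P K L) {a : ι → ℝ} (ha : ‖a‖ ≤ K) :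
    |P a| ≤ L * ‖a‖ ^ 2 := by
  simpa [hP.zero, hP.fderiv_zero] using hP.taylor 0 a (by simpa using hP.nonneg_radius) ha

theorem integrable_comp_valueAt (hP : QuadraticOn P K L) (hU : BoundedBy K U) :
    Integrable (fun x => P (valueAt U x)) (volume : Measure Space) := by
  refine ((integrable_mul (sumAbs U) (sumAbs U)).const_mul L).mono'
    (hP.contDiff.continuous.comp_aestronglyMeasurable (aestronglyMeasurable_valueAt U)) ?_
  filter_upwards [hU, norm_valueAt_le_sumAbs U] with x h1 h2
  refine (hP.abs_le h1).trans ?_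
  have := hP.nonneg
  rw [← sq]
  gcongr

theorem valueAt_toLp (w : ι → 𝓢(Space, ℝ)) :
    ∀ᵐ x, valueAt (fun k => (w k).toLp 2 (volume : Measure Space)) x = fun k => w k x := by
  filter_upwards [ae_all_iff.mpr fun k => (w k).coeFn_toLp 2 volume] with x hx
  exact funext hx

theorem boundedBy_toLp (hK : 0 ≤ K) {w : ι → 𝓢(Space, ℝ)} (hw : ∀ k x, |w k x| ≤ K) :
    BoundedBy K fun k => (w k).toLp 2 (volume : Measure Space) := by
  filter_upwards [valueAt_toLp w] with x hx
  rw [hx]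
  exact (pi_norm_le_iff_of_nonneg hK).mpr fun k => hw k x

/-- The integral of a derivative of `P ∘ w` vanishes, for Schwartz functions `w`. -/
theorem integral_fderiv_comp_schwartz (hP : QuadraticOn P K L) {w : ι → 𝓢(Space, ℝ)}
    (hw : ∀ k x, |w k x| ≤ K) (m : Space) :
    ∫ x, fderiv ℝ P (fun k => w k x) (fun k => (∂_{m} (w k)) x) = 0 := by
  have hb := boundedBy_toLp hP.nonneg_radius hw
  have hPd : Differentiable ℝ P := hP.contDiff.differentiable (by norm_num)
  have hF : ∀ x, HasFDerivAt (fun x => P (fun k => w k x))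
      ((fderiv ℝ P (fun k => w k x)).comp (ContinuousLinearMap.pi fun k => fderiv ℝ (w k) x)) x :=
    fun x => (hPd _).hasFDerivAt.comp x (hasFDerivAt_pi.mpr fun k => (w k).hasFDerivAt x)
  have hFm : ∀ x, fderiv ℝ (fun x => P (fun k => w k x)) x m
      = fderiv ℝ P (fun k => w k x) (fun k => (∂_{m} (w k)) x) := fun x => by
    rw [(hF x).fderiv]
    simp only [SchwartzMap.lineDerivOp_apply_eq_fderiv]
    rfl
  have hF1 : Integrable (fun x => P (fun k => w k x)) (volume : Measure Space) := by
    refine (integrable_comp_valueAt hP hb).congr ?_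
    filter_upwards [valueAt_toLp w] with x hx
    rw [hx]
  have hF2 : Integrable (fun x => fderiv ℝ P (fun k => w k x) (fun k => (∂_{m} (w k)) x))
      (volume : Measure Space) := by
    refine (integrable_fderiv_valueAt_apply hP hb
      fun k => (∂_{m} (w k)).toLp 2 (volume : Measure Space)).congr ?_
    filter_upwards [valueAt_toLp w, valueAt_toLp fun k => ∂_{m} (w k)] with x h1 h2
    rw [h1, h2]
  -- Integration by parts against the constant `1`; it needs only that `P ∘ w` and its derivative
  -- are integrable.
  have := integral_mul_fderiv_eq_neg_fderiv_mul_of_integrable (μ := (volume : Measure Space))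
    (f := fun _ => (1 : ℝ)) (g := fun x => P (fun k => w k x)) (v := m)
    (by simp) (by simpa [hFm] using hF2) (by simpa using hF1)
    (by simp) (fun x _ => (hF x).differentiableAt)
  simpa [hFm] using this

/-- The integral of a derivative of `P ∘ U` vanishes, for `U` bounded and in `H¹`. -/
theorem integral_fderiv_comp_weakDeriv (hP : QuadraticOn P K L) {u : ι → ℕ → 𝓢(Space, ℝ)}
    (hu : ∀ k, SchwartzApprox K (U k) (fun j => weakDeriv j (U k)) (u k)) (j : Fin 3) :
    ∫ x, fderiv ℝ P (valueAt U x) (valueAt (fun k => weakDeriv j (U k)) x) = 0 := by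
  have hU : BoundedBy K U := boundedBy_of_forall hP.nonneg_radius fun k => (hu k).ae_abs_le
  have hw : ∀ n, BoundedBy K fun k => (u k n).toLp 2 (volume : Measure Space) := fun n =>
    boundedBy_toLp hP.nonneg_radius fun k => (hu k).bound n
  rw [integral_fderiv_valueAt_apply hP hU]
  -- Both factors of each pairing converge strongly in L², so the vanishing integral passes to the
  -- limit.
  have h1 : Tendsto (fun n => ∑ k, inner ℝ
      (partialComp P k fun k => (u k n).toLp 2 (volume : Measure Space))
      ((∂_{basisVec j} (u k n)).toLp 2 (volume : Measure Space))) atTop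
      (𝓝 (∑ k, inner ℝ (partialComp P k U) (weakDeriv j (U k)))) :=
    tendsto_finsetSum _ fun k _ => (tendsto_partialComp hP hw hU (fun k => (hu k).tendsto) k).inner
      ((hu k).tendsto_deriv j)
  refine tendsto_nhds_unique h1 (tendsto_const_nhds.congr fun n => ?_)
  refine Eq.trans ?_ (integral_fderiv_valueAt_apply hP (hw n)
    fun k => (∂_{basisVec j} (u k n)).toLp 2 volume)
  rw [← integral_fderiv_comp_schwartz hP (w := fun k => u k n) (fun k => (hu k).bound n)
    (basisVec j)]
  refine integral_congr_ae ?_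
  filter_upwards [valueAt_toLp fun k => u k n, valueAt_toLp fun k => ∂_{basisVec j} (u k n)]
    with x h1 h2
  rw [h1, h2]

/-- The pointwise Taylor estimate, integrated. The remainder is quadratic in the L² distance, so L²
differentiability in time suffices for the chain rule below. -/
theorem abs_integral_taylor_le (hP : QuadraticOn P K L) (hU : BoundedBy K U)
    (hW : BoundedBy K W) :
    |(∫ x, P (valueAt W x)) - (∫ x, P (valueAt U x))
        - ∑ k, inner ℝ (partialComp P k U) (W k - U k)| ≤ L * (∑ k, ‖W k - U k‖) ^ 2 := by
  have hL := hP.nonneg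
  have hWU : Integrable (fun x => P (valueAt W x) - P (valueAt U x)) (volume : Measure Space) :=
    (integrable_comp_valueAt hP hW).sub (integrable_comp_valueAt hP hU)
  rw [← integral_fderiv_valueAt_apply hP hU fun k => W k - U k,
    ← integral_sub (integrable_comp_valueAt hP hW) (integrable_comp_valueAt hP hU),
    ← integral_sub hWU (integrable_fderiv_valueAt_apply hP hU _)]
  calc _ ≤ ∫ x, L * (sumAbs (fun k => W k - U k) x * sumAbs (fun k => W k - U k) x) := by
        rw [← Real.norm_eq_abs]
        refine norm_integral_le_of_norm_le ((integrable_mul _ _).const_mul L) ?_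
        filter_upwards [hU, hW, valueAt_sub W U, norm_valueAt_le_sumAbs fun k => W k - U k]
          with x h1 h2 h3 h4
        rw [h3] at h4 ⊢
        refine (hP.taylor _ _ h1 h2).trans ?_
        rw [← sq]
        gcongr
    _ = L * ‖sumAbs fun k => W k - U k‖ ^ 2 := by
        rw [integral_const_mul, ← inner_eq_integral_mul, real_inner_self_eq_norm_sq]
    _ ≤ _ := by
        gcongr
        exact norm_sumAbs_le _

/-- The chain rule for `τ ↦ ∫ P (U τ)`, when `U` is differentiable in `L²` and bounded. -/
theorem hasDerivWithinAt_integral_comp (hP : QuadraticOn P K L) {S : Set ℝ} {t : ℝ} (ht : t ∈ S)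
    {U : ℝ → ι → L2} (hU : ∀ τ ∈ S, BoundedBy K (U τ)) {U' : ι → L2}
    (h : ∀ k, HasDerivWithinAt (fun τ => U τ k) (U' k) S t) :
    HasDerivWithinAt (fun τ => ∫ x, P (valueAt (U τ) x))
      (∫ x, fderiv ℝ P (valueAt (U t) x) (valueAt U' x)) S t := by
  rw [integral_fderiv_valueAt_apply hP (hU t ht)]
  have h1 : HasDerivWithinAt
      (fun τ => ∑ k, inner ℝ (partialComp P k (U t)) (U τ k - U t k))
      (∑ k, inner ℝ (partialComp P k (U t)) (U' k)) S t :=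
    HasDerivWithinAt.fun_sum fun k _ => by
      simpa using (hasDerivWithinAt_const t S (partialComp P k (U t))).inner ℝ
        ((h k).sub_const (U t k))
  have h2 : HasDerivWithinAt (fun τ => (∫ x, P (valueAt (U τ) x)) - (∫ x, P (valueAt (U t) x))
      - ∑ k, inner ℝ (partialComp P k (U t)) (U τ k - U t k)) 0 S t := by
    rw [hasDerivWithinAt_iff_isLittleO]
    have h3 : (fun τ => ∑ k, ‖U τ k - U t k‖) =O[𝓝[S] t] fun τ => τ - t :=
      Asymptotics.IsBigO.fun_sum fun k _ => (h k).hasFDerivWithinAt.isBigO_sub.norm_left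
    have h4 : (fun τ : ℝ => (τ - t) * (τ - t)) =o[𝓝[S] t] fun τ => τ - t := by
      have : (fun τ : ℝ => τ - t) =o[𝓝[S] t] fun _ => (1 : ℝ) := by
        rw [Asymptotics.isLittleO_one_iff]
        have h5 : Tendsto (fun τ : ℝ => τ - t) (𝓝 t) (𝓝 (t - t)) :=
          (continuous_id.sub continuous_const).tendsto t
        rw [sub_self] at h5
        exact h5.mono_left nhdsWithin_le_nhds
      simpa using this.mul_isBigO (Asymptotics.isBigO_refl (fun τ : ℝ => τ - t) (𝓝[S] t))
    refine Asymptotics.IsBigO.trans_isLittleO ?_ h4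
    refine Asymptotics.IsBigO.trans ?_ (h3.mul h3)
    refine Asymptotics.IsBigO.of_bound L ?_
    filter_upwards [self_mem_nhdsWithin] with τ hτ
    have h6 := abs_integral_taylor_le hP (hU t ht) (hU τ hτ)
    simpa [← sq, abs_of_nonneg] using h6
  have h7 := (h2.add h1).add_const (∫ x, P (valueAt (U t) x))
  rw [zero_add] at h7
  refine h7.congr (fun τ _ => ?_) ?_ <;> simp

end

/-! ### Grönwall's lemma. -/

/-- `E'` need not be integrable: as `E` is differentiable everywhere, an integrable majorant of `E'`
is enough for this half of the fundamental theorem of calculus. -/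
theorem sub_le_integral_mul {T : ℝ} {E E' a : ℝ → ℝ}
    (hE : ∀ t ∈ Icc 0 T, HasDerivWithinAt E (E' t) (Icc 0 T) t)
    (ha : IntegrableOn a (Icc 0 T)) (hle : ∀ᵐ t ∂(volume.restrict (Icc 0 T)), E' t ≤ a t * E t)
    {t₁ t₂ : ℝ} (h₁ : 0 ≤ t₁) (h₁₂ : t₁ ≤ t₂) (h₂ : t₂ ≤ T) :
    E t₂ - E t₁ ≤ ∫ t in t₁..t₂, a t * E t := by
  classical
  have hsub : Icc t₁ t₂ ⊆ Icc 0 T := Icc_subset_Icc h₁ h₂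
  have hcont : ContinuousOn E (Icc 0 T) := fun t ht => (hE t ht).continuousWithinAt
  have haE : IntegrableOn (fun t => a t * E t) (Icc t₁ t₂) :=
    (ha.mul_continuousOn hcont isCompact_Icc).mono_set hsub
  -- The majorant must dominate `E'` at every point, so it is changed to `E'` on the null set where
  -- the inequality fails.
  let b : ℝ → ℝ := fun t => if E' t ≤ a t * E t then a t * E t else E' t
  have hb : b =ᵐ[volume.restrict (Icc t₁ t₂)] fun t => a t * E t := by
    filter_upwards [ae_restrict_of_ae_restrict_of_subset hsub hle] with t ht
    simp [b, ht]
  have h := intervalIntegral.sub_le_integral_of_hasDeriv_right_of_le h₁₂ (hcont.mono hsub)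
    (fun t ht => ((hE t (hsub (Ioo_subset_Icc_self ht))).mono_of_mem_nhdsWithin
      (mem_nhdsWithin_of_mem_nhds (Icc_mem_nhds (h₁.trans_lt ht.1) (ht.2.trans_le h₂)))))
    (haE.congr hb.symm) (fun t _ => by
      by_cases h : E' t ≤ a t * E t
      · simp [b, h]
      · simp [b, h])
  refine h.trans_eq (intervalIntegral.integral_congr_ae_restrict ?_)
  rw [uIoc_of_le h₁₂]
  exact ae_restrict_of_ae_restrict_of_subset Ioc_subset_Icc_self hb

/-- Grönwall's lemma with an integrable coefficient, for an everywhere differentiable function. -/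
theorem eq_zero_of_deriv_le_mul {T : ℝ} {E E' a : ℝ → ℝ}
    (hE : ∀ t ∈ Icc 0 T, HasDerivWithinAt E (E' t) (Icc 0 T) t) (hE0 : E 0 = 0)
    (hnn : ∀ t ∈ Icc 0 T, 0 ≤ E t) (ha0 : ∀ t, 0 ≤ a t) (ha : IntegrableOn a (Icc 0 T))
    (hle : ∀ᵐ t ∂(volume.restrict (Icc 0 T)), E' t ≤ a t * E t) :
    ∀ t ∈ Icc 0 T, E t = 0 := by
  have hcont : ContinuousOn E (Icc 0 T) := fun t ht => (hE t ht).continuousWithinAt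
  have hclosed : IsClosed ({t | E t = 0} ∩ Icc 0 T) := by
    rw [inter_comm]
    exact hcont.preimage_isClosed_of_isClosed isClosed_Icc isClosed_singleton
  -- Continuous induction: the zero set is closed, and from each of its points `x < T` another zero
  -- is found to the right, as near as desired.
  refine hclosed.Icc_subset_of_forall_exists_gt hE0 fun x ⟨hx0, hx⟩ y hy => ?_
  have hxT : x < min y T := lt_min hy hx.2
  have hA : ContinuousWithinAt (fun z => ∫ t in x..z, a t) (Icc x T) x := by
    have := intervalIntegral.continuousOn_primitive_interval (a := x) (b := T) (f := a)
      (μ := volume) (by rw [uIcc_of_le hx.2.le]; exact ha.mono_set (Icc_subset_Icc_left hx.1))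
    rw [uIcc_of_le hx.2.le] at this
    exact this x (left_mem_Icc.mpr hx.2.le)
  have hev : ∀ᶠ z in 𝓝[>] x, ∫ t in x..z, a t < 1 / 2 := by
    have h1 := hA.tendsto
    rw [intervalIntegral.integral_same] at h1
    exact nhdsWithin_le_of_mem (mem_of_superset (Ioc_mem_nhdsGT hx.2) Ioc_subset_Icc_self)
      (h1.eventually_lt_const (by norm_num))
  obtain ⟨z, hz1, hz2⟩ := (hev.and (Ioc_mem_nhdsGT hxT)).exists
  have hzT : z ≤ T := hz2.2.trans (min_le_right _ _)
  have hsub : Icc x z ⊆ Icc 0 T := Icc_subset_Icc hx.1 hzT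
  obtain ⟨c, hc, hmax⟩ := isCompact_Icc.exists_isMaxOn (nonempty_Icc.mpr hz2.1.le)
    (hcont.mono hsub)
  have hai : ∀ {p q : ℝ}, x ≤ p → p ≤ q → q ≤ z → IntervalIntegrable a volume p q :=
    fun hp hpq hq => (intervalIntegrable_iff_integrableOn_Icc_of_le hpq).mpr
      (ha.mono_set ((Icc_subset_Icc hp hq).trans hsub))
  -- At a maximum point `c` of `E` on `[x, z]`, the integral inequality gives `E c ≤ (∫ a) E c`, and
  -- `z` was chosen so that this integral is below `1/2`.
  have hEc : E c ≤ (1 / 2) * E c := by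
    have h1 := sub_le_integral_mul hE ha hle hx.1 hc.1 (hc.2.trans hzT)
    have h2 : ∫ t in x..c, a t * E t ≤ ∫ t in x..c, a t * E c := by
      refine intervalIntegral.integral_mono_on hc.1 ?_ ((hai le_rfl hc.1 hc.2).mul_const _) ?_
      · refine (hai le_rfl hc.1 hc.2).mul_continuousOn (hcont.mono ?_)
        rw [uIcc_of_le hc.1]
        exact (Icc_subset_Icc_right hc.2).trans hsub
      · exact fun t ht => mul_le_mul_of_nonneg_left (hmax ⟨ht.1, ht.2.trans hc.2⟩) (ha0 t)
    have h3 : ∫ t in x..c, a t ≤ ∫ t in x..z, a t := by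
      rw [← intervalIntegral.integral_add_adjacent_intervals (hai le_rfl hc.1 hc.2)
        (hai hc.1 hc.2 le_rfl)]
      exact le_add_of_nonneg_right (intervalIntegral.integral_nonneg hc.2 fun t _ => ha0 t)
    rw [intervalIntegral.integral_mul_const] at h2
    have hx0' : E x = 0 := hx0
    rw [hx0', sub_zero] at h1
    exact h1.trans (h2.trans (mul_le_mul_of_nonneg_right (h3.trans hz1.le) (hnn c (hsub hc))))
  have hEz : E z ≤ E c := hmax (right_mem_Icc.mpr hz2.1.le)
  have hz0 := hnn z (hsub (right_mem_Icc.mpr hz2.1.le))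
  exact ⟨z, show E z = 0 by linarith, hz2.1, hz2.2.trans (min_le_left _ _)⟩

/-! ### Measurability and integrability in time of the gradient norms. -/

/-- A lower semicontinuous function of an L²-continuous curve is Borel; no continuity in `L^∞` is
needed. -/
theorem aemeasurable_eLpNorm_top {T : ℝ} {f : ℝ → L2} (hf : ContinuousOn f (Icc 0 T)) :
    AEMeasurable (fun t => eLpNorm (f t) ⊤ (volume : Measure Space))
      (volume.restrict (Icc 0 T)) := by
  have h : Measurable fun t : Icc (0 : ℝ) T => eLpNorm (f t) ⊤ (volume : Measure Space) :=
    (lowerSemicontinuous_eLpNorm_top.comp hf.domRestrict).measurable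
  exact (aemeasurable_restrict_iff_comap_subtype measurableSet_Icc).mpr h.aemeasurable

theorem lintegral_lt_top_of_normSqL2Linfty {T : ℝ} {f : ℝ → L2} (hf : normSqL2Linfty T f < ⊤) :
    ∫⁻ t in Icc 0 T, eLpNorm (f t) ⊤ (volume : Measure Space) < ⊤ := by
  calc _ ≤ ∫⁻ t in Icc 0 T, (1 + eLpNorm (f t) ⊤ (volume : Measure Space) ^ 2) := by
        refine lintegral_mono fun t => ?_
        rcases le_total (eLpNorm (f t) ⊤ (volume : Measure Space)) 1 with h | h
        · exact h.trans le_self_add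
        · exact (le_self_pow₀ h two_ne_zero).trans le_add_self
    _ < ⊤ := by
        rw [lintegral_add_left measurable_const]
        simp only [lintegral_const, one_mul, Measure.restrict_apply_univ]
        exact ENNReal.add_lt_top.mpr ⟨measure_Icc_lt_top, hf⟩

/-- `L²`-continuous curves that are bounded in `H^s`, `s ≥ 2`, have `L²`-continuous weak space
derivatives. -/
theorem continuousOn_weakDeriv {s T C : ℝ} (hs : 2 ≤ s) {f : ℝ → L2}
    (hf : ContinuousOn f (Icc 0 T)) (hb : ∀ t ∈ Icc 0 T, HsNormLE s (f t) C) (j : Fin 3) :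
    ContinuousOn (fun t => weakDeriv j (f t)) (Icc 0 T) := by
  obtain ⟨K, hK, h⟩ := HsNormLE.exists_schwartzApprox_weakDeriv hs
  intro t ht
  rw [ContinuousWithinAt, tendsto_iff_norm_sub_tendsto_zero]
  let M := K * (C + 1)
  have h1 : Tendsto (fun τ => √(‖f τ - f t‖ * (M + M))) (𝓝[Icc 0 T] t) (𝓝 0) := by
    have h2 := ((tendsto_iff_norm_sub_tendsto_zero.mp (hf t ht)).mul_const (M + M)).sqrt
    simpa using h2
  refine squeeze_zero' (.of_forall fun _ => norm_nonneg _) ?_ h1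
  filter_upwards [self_mem_nhdsWithin] with τ hτ
  obtain ⟨u, hu⟩ := h (f τ) C (hb τ hτ)
  obtain ⟨u', hu'⟩ := h (f t) C (hb t ht)
  exact Real.le_sqrt_of_sq_le ((hu.sub hu').norm_deriv_sq_le j)

/-! ### The energy density, its flux and the pointwise energy estimate. -/

/-- The indices of the unknowns of a pair of solutions: two velocities and two logarithmic
densities. -/
abbrev PairIndex : Type := (Fin 3 ⊕ Unit) ⊕ (Fin 3 ⊕ Unit)

/-- The values of a pair of solutions. -/
def pairState {α : Type*} (v : Fin 3 → α) (ρ : α) (φ : Fin 3 → α) (ψ : α) : PairIndex → α :=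
  Sum.elim (Sum.elim v fun _ => ρ) (Sum.elim φ fun _ => ψ)

/-- The energy density `|v - φ|² + A e^{kρ} (ρ - ψ)²` of the difference of two solutions. -/
noncomputable def energyDensity (A k : ℝ) (a : PairIndex → ℝ) : ℝ :=
  ∑ i, (a (.inl (.inl i)) - a (.inr (.inl i))) ^ 2
    + A * Real.exp (k * a (.inl (.inr ()))) * (a (.inl (.inr ())) - a (.inr (.inr ()))) ^ 2

/-- The `j`-th component of the energy flux of the difference of two solutions. -/
noncomputable def energyFlux (A k : ℝ) (j : Fin 3) (a : PairIndex → ℝ) : ℝ :=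
  a (.inl (.inl j)) * energyDensity A k a
    + 2 * (A * Real.exp (k * a (.inl (.inr ()))) * (a (.inl (.inr ())) - a (.inr (.inr ())))
      * (a (.inl (.inl j)) - a (.inr (.inl j))))

theorem contDiff_energyDensity (A k : ℝ) {n : ℕ∞} : ContDiff ℝ n (energyDensity A k) := by
  unfold energyDensity; fun_prop

theorem contDiff_energyFlux (A k : ℝ) (j : Fin 3) {n : ℕ∞} : ContDiff ℝ n (energyFlux A k j) := by
  unfold energyFlux energyDensity; fun_prop

/-- Derivatives along lines give explicit values of `fderiv` on vectors, through
`fderiv_apply_eq_of_hasDerivAt_line`. -/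
theorem hasDerivAt_energyDensity_line (A k : ℝ) (a y : PairIndex → ℝ) :
    HasDerivAt (fun s : ℝ => energyDensity A k (a + s • y))
      (∑ i, 2 * (a (.inl (.inl i)) - a (.inr (.inl i))) * (y (.inl (.inl i)) - y (.inr (.inl i)))
        + A * Real.exp (k * a (.inl (.inr ()))) * (k * y (.inl (.inr ()))
            * (a (.inl (.inr ())) - a (.inr (.inr ()))) ^ 2
          + 2 * (a (.inl (.inr ())) - a (.inr (.inr ())))
            * (y (.inl (.inr ())) - y (.inr (.inr ()))))) 0 := by
  have hc : ∀ c, HasDerivAt (fun s : ℝ => (a + s • y) c) (y c) 0 := fun c => by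
    simpa using ((hasDerivAt_id (0 : ℝ)).mul_const (y c)).const_add (a c)
  have h := (HasDerivAt.fun_sum (u := Finset.univ) fun i (_ : i ∈ Finset.univ) =>
    ((hc (.inl (.inl i))).sub (hc (.inr (.inl i)))).pow 2).add
    ((((hc (.inl (.inr ()))).const_mul k).exp.const_mul A).mul
      (((hc (.inl (.inr ()))).sub (hc (.inr (.inr ())))).pow 2))
  refine h.congr_deriv ?_
  simp
  ring

theorem hasDerivAt_energyFlux_line (A k : ℝ) (j : Fin 3) (a y : PairIndex → ℝ) :
    HasDerivAt (fun s : ℝ => energyFlux A k j (a + s • y))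
      (y (.inl (.inl j)) * energyDensity A k a
        + a (.inl (.inl j)) *
          (∑ i, 2 * (a (.inl (.inl i)) - a (.inr (.inl i)))
              * (y (.inl (.inl i)) - y (.inr (.inl i)))
            + A * Real.exp (k * a (.inl (.inr ()))) * (k * y (.inl (.inr ()))
                * (a (.inl (.inr ())) - a (.inr (.inr ()))) ^ 2
              + 2 * (a (.inl (.inr ())) - a (.inr (.inr ())))
                * (y (.inl (.inr ())) - y (.inr (.inr ())))))
        + 2 * (A * Real.exp (k * a (.inl (.inr ())))) *
          (k * y (.inl (.inr ())) * (a (.inl (.inr ())) - a (.inr (.inr ())))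
              * (a (.inl (.inl j)) - a (.inr (.inl j)))
            + (y (.inl (.inr ())) - y (.inr (.inr ()))) * (a (.inl (.inl j)) - a (.inr (.inl j)))
            + (a (.inl (.inr ())) - a (.inr (.inr ())))
              * (y (.inl (.inl j)) - y (.inr (.inl j))))) 0 := by
  have hc : ∀ c, HasDerivAt (fun s : ℝ => (a + s • y) c) (y c) 0 := fun c => by
    simpa using ((hasDerivAt_id (0 : ℝ)).mul_const (y c)).const_add (a c)
  have h := ((hc (.inl (.inl j))).mul (hasDerivAt_energyDensity_line A k a y)).add
    ((((((hc (.inl (.inr ()))).const_mul k).exp.const_mul A).mul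
      ((hc (.inl (.inr ()))).sub (hc (.inr (.inr ()))))).mul
      ((hc (.inl (.inl j))).sub (hc (.inr (.inl j))))).const_mul 2)
  refine h.congr_deriv ?_
  simp
  ring

theorem fderiv_apply_eq_of_hasDerivAt_line {ι : Type*} [Fintype ι] {P : (ι → ℝ) → ℝ}
    (hP : ContDiff ℝ (1 : ℕ∞) P) {a y : ι → ℝ} {d : ℝ}
    (h : HasDerivAt (fun s : ℝ => P (a + s • y)) d 0) : fderiv ℝ P a y = d := by
  rw [← (hP.differentiable (by norm_num) a).lineDeriv_eq_fderiv]
  exact h.deriv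

theorem fderiv_energyDensity_zero (A k : ℝ) : fderiv ℝ (energyDensity A k) 0 = 0 := by
  ext y
  rw [fderiv_apply_eq_of_hasDerivAt_line (contDiff_energyDensity A k)
    (hasDerivAt_energyDensity_line A k _ _)]
  simp

theorem energyDensity_zero (A k : ℝ) : energyDensity A k 0 = 0 := by
  simp [energyDensity]

theorem fderiv_energyFlux_zero (A k : ℝ) (j : Fin 3) : fderiv ℝ (energyFlux A k j) 0 = 0 := by
  ext y
  rw [fderiv_apply_eq_of_hasDerivAt_line (contDiff_energyFlux A k j)
    (hasDerivAt_energyFlux_line A k j _ _)]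
  simp [energyDensity]

theorem energyFlux_zero (A k : ℝ) (j : Fin 3) : energyFlux A k j 0 = 0 := by
  simp [energyFlux]

/-- The local energy identity for the difference of two solutions: all terms with derivatives of
the difference cancel. -/
theorem energy_identity (A k : ℝ) {v φ tv tφ dρ dψ : Fin 3 → ℝ} {ρ ψ tρ tψ : ℝ}
    {dv dφ : Fin 3 → Fin 3 → ℝ}
    (hv : ∀ i, tv i + ∑ j, v j * dv j i = - (A * Real.exp (k * ρ)) * dρ i)
    (hφ : ∀ i, tφ i + ∑ j, φ j * dφ j i = - (A * Real.exp (k * ψ)) * dψ i)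
    (hρ : tρ + ∑ j, v j * dρ j = - ∑ j, dv j j) (hψ : tψ + ∑ j, φ j * dψ j = - ∑ j, dφ j j) :
    fderiv ℝ (energyDensity A k) (pairState v ρ φ ψ) (pairState tv tρ tφ tψ)
      + ∑ j, fderiv ℝ (energyFlux A k j) (pairState v ρ φ ψ)
        (pairState (dv j) (dρ j) (dφ j) (dψ j))
      = (∑ j, dv j j) * ∑ i, (v i - φ i) ^ 2 - 2 * ∑ i, ∑ j, (v i - φ i) * (v j - φ j) * dφ j i
        - 2 * A * (Real.exp (k * ρ) - Real.exp (k * ψ)) * ∑ i, (v i - φ i) * dψ i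
        + A * Real.exp (k * ρ) * ((1 - k) * (∑ j, dv j j) * (ρ - ψ) ^ 2
          - 2 * (ρ - ψ) * ∑ j, (v j - φ j) * dψ j + 2 * k * (ρ - ψ) * ∑ j, (v j - φ j) * dρ j) := by
  rw [fderiv_apply_eq_of_hasDerivAt_line (contDiff_energyDensity A k)
    (hasDerivAt_energyDensity_line A k _ _)]
  simp_rw [fderiv_apply_eq_of_hasDerivAt_line (contDiff_energyFlux A k _)
    (hasDerivAt_energyFlux_line A k _ _ _)]
  -- Once the time derivatives are eliminated, the claim is a polynomial identity in the remaining
  -- quantities and the exponentials.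
  have hv' : ∀ i, tv i = - (A * Real.exp (k * ρ)) * dρ i - ∑ j, v j * dv j i := fun i => by
    rw [← hv i]; ring
  have hφ' : ∀ i, tφ i = - (A * Real.exp (k * ψ)) * dψ i - ∑ j, φ j * dφ j i := fun i => by
    rw [← hφ i]; ring
  have hρ' : tρ = - ∑ j, dv j j - ∑ j, v j * dρ j := by rw [← hρ]; ring
  have hψ' : tψ = - ∑ j, dφ j j - ∑ j, φ j * dψ j := by rw [← hψ]; ring
  simp only [pairState, energyDensity, Sum.elim_inl, Sum.elim_inr, hv', hφ', hρ', hψ',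
    Fin.sum_univ_three]
  ring

theorem abs_exp_mul_sub_exp_mul_le (k : ℝ) {K ρ ψ : ℝ} (hρ : |ρ| ≤ K) (hψ : |ψ| ≤ K) :
    |Real.exp (k * ρ) - Real.exp (k * ψ)| ≤ |k| * Real.exp (|k| * K) * |ρ - ψ| := by
  have hd : ∀ x, HasDerivAt (fun x => Real.exp (k * x)) (Real.exp (k * x) * k) x := fun x => by
    simpa using ((hasDerivAt_id x).const_mul k).exp
  refine (convex_Icc (-K) K).norm_image_sub_le_of_norm_hasDerivWithin_le
    (fun x _ => (hd x).hasDerivWithinAt) (fun x hx => ?_) (abs_le.mp hψ) (abs_le.mp hρ)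
  rw [norm_mul, Real.norm_eq_abs, Real.norm_eq_abs, Real.abs_exp, mul_comm]
  refine mul_le_mul_of_nonneg_left (Real.exp_le_exp.mpr ?_) (abs_nonneg k)
  calc k * x ≤ |k * x| := le_abs_self _
    _ ≤ |k| * K := by rw [abs_mul]; gcongr; exact abs_le.mpr hx

/-- The common shape of the terms to be estimated: a bounded coefficient `c`, two components `p`,
`q` of the difference, and one derivative `d`. -/
theorem two_mul_le_of_abs_le {c d p q Γ m : ℝ} (hc : |c| ≤ Γ) (hd : |d| ≤ m) :
    2 * (c * p * q * d) ≤ Γ * m * (p ^ 2 + q ^ 2) := by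
  have hm : 0 ≤ m := (abs_nonneg _).trans hd
  have hΓ : 0 ≤ Γ := (abs_nonneg _).trans hc
  have h : |c * d| ≤ Γ * m := by rw [abs_mul]; gcongr
  have h1 : 2 * |p * q| ≤ p ^ 2 + q ^ 2 := by
    rw [abs_mul]; nlinarith [sq_nonneg (|p| - |q|), sq_abs p, sq_abs q]
  calc 2 * (c * p * q * d) = 2 * ((c * d) * (p * q)) := by ring
    _ ≤ 2 * (|c * d| * |p * q|) := by rw [← abs_mul]; gcongr; exact le_abs_self _
    _ = |c * d| * (2 * |p * q|) := by ring
    _ ≤ Γ * m * (p ^ 2 + q ^ 2) := by gcongr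

/-- The right-hand side of the local energy identity is controlled by the energy density. -/
theorem exists_energy_bound {A : ℝ} (hA : 0 < A) (k K : ℝ) :
    ∃ C, 0 ≤ C ∧ ∀ {w dρ dψ : Fin 3 → ℝ} {ρ ψ m : ℝ} {dv dφ : Fin 3 → Fin 3 → ℝ},
      |ρ| ≤ K → |ψ| ≤ K → (∀ i j, |dv j i| ≤ m) → (∀ i j, |dφ j i| ≤ m) → (∀ j, |dρ j| ≤ m) →
      (∀ j, |dψ j| ≤ m) →
      (∑ j, dv j j) * ∑ i, w i ^ 2 - 2 * ∑ i, ∑ j, w i * w j * dφ j i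
        - 2 * A * (Real.exp (k * ρ) - Real.exp (k * ψ)) * ∑ i, w i * dψ i
        + A * Real.exp (k * ρ) * ((1 - k) * (∑ j, dv j j) * (ρ - ψ) ^ 2
          - 2 * (ρ - ψ) * ∑ j, w j * dψ j + 2 * k * (ρ - ψ) * ∑ j, w j * dρ j)
      ≤ C * m * (∑ i, w i ^ 2 + A * Real.exp (k * ρ) * (ρ - ψ) ^ 2) := by
  -- For `|ρ| ≤ K` the weight `A e^{kρ}` lies between `β` and `Λ`. `C₁` adds up the constants of
  -- `h1` to `h6` below, its `9` being `3 + 6` from `h1` and `h2`; the factor `1 + β⁻¹` turns the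
  -- unweighted square of `ρ - ψ` into the weighted one.
  let e := Real.exp (|k| * K)
  let Λ := A * e
  let β := A * Real.exp (-(|k| * K))
  let C₁ := 9 + 3 * (A * (|k| * e)) + 3 * (Λ * (1 + |k|)) + 3 * Λ + 3 * (Λ * |k|)
  have hβ : 0 < β := by positivity
  have hΛ : 0 ≤ Λ := by positivity
  have hC₁ : 0 ≤ C₁ := by positivity
  refine ⟨C₁ * (1 + β⁻¹), by positivity, ?_⟩
  intro w dρ dψ ρ ψ m dv dφ hρ hψ hdv hdφ hdρ hdψ
  have hm : 0 ≤ m := (abs_nonneg _).trans (hdρ 0)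
  have hkρ : |k * ρ| ≤ |k| * K := by rw [abs_mul]; gcongr
  let b := A * Real.exp (k * ρ)
  have hb0 : 0 < b := by positivity
  have hbΛ : b ≤ Λ := by
    refine mul_le_mul_of_nonneg_left (Real.exp_le_exp.mpr ?_) hA.le
    exact (le_abs_self _).trans hkρ
  have hbβ : β ≤ b := by
    refine mul_le_mul_of_nonneg_left (Real.exp_le_exp.mpr ?_) hA.le
    exact neg_le_of_abs_le hkρ
  -- The difference of the two weights becomes a bounded coefficient times `ρ - ψ`, so that its term
  -- is quadratic in the difference.
  obtain ⟨θ, hθ, hθe⟩ : ∃ θ, |θ| ≤ |k| * e ∧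
      Real.exp (k * ρ) - Real.exp (k * ψ) = θ * (ρ - ψ) := by
    by_cases h : ρ - ψ = 0
    · exact ⟨0, by simp; positivity, by rw [sub_eq_zero.mp h]; simp⟩
    · refine ⟨(Real.exp (k * ρ) - Real.exp (k * ψ)) / (ρ - ψ), ?_, by field_simp⟩
      rw [abs_div, div_le_iff₀ (abs_pos.mpr h)]
      exact abs_exp_mul_sub_exp_mul_le k hρ hψ
  rw [hθe]
  set r := ρ - ψ
  have hbabs : |b| ≤ Λ := by rwa [abs_of_pos hb0]
  have hAθ : |-(A * θ)| ≤ A * (|k| * e) := by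
    rw [abs_neg, abs_mul, abs_of_pos hA]; gcongr
  have hb1k : |b * (1 - k)| ≤ Λ * (1 + |k|) := by
    rw [abs_mul]; gcongr; simpa using abs_sub (1 : ℝ) k
  have hbk : |b * k| ≤ Λ * |k| := by rw [abs_mul]; gcongr
  have hnb : |-b| ≤ Λ := by rwa [abs_neg]
  have h1 : (∑ j, dv j j) * ∑ i, w i ^ 2 ≤ 3 * m * ∑ i, w i ^ 2 := by
    gcongr
    calc ∑ j, dv j j ≤ ∑ _j : Fin 3, m :=
          Finset.sum_le_sum fun j _ => (le_abs_self _).trans (hdv j j)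
      _ = 3 * m := by simp
  have h2 : - (2 * ∑ i, ∑ j, w i * w j * dφ j i) ≤ 6 * m * ∑ i, w i ^ 2 := by
    calc _ = ∑ i, ∑ j, 2 * (-1 * w i * w j * dφ j i) := by
          simp only [Finset.mul_sum, ← Finset.sum_neg_distrib]
          exact Finset.sum_congr rfl fun i _ => Finset.sum_congr rfl fun j _ => by ring
      _ ≤ ∑ i, ∑ j, 1 * m * (w i ^ 2 + w j ^ 2) := Finset.sum_le_sum fun i _ =>
          Finset.sum_le_sum fun j _ => two_mul_le_of_abs_le (by simp) (hdφ i j)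
      _ = _ := by simp only [Fin.sum_univ_three]; ring
  have h3 : - (2 * A * (θ * r) * ∑ i, w i * dψ i)
      ≤ (A * (|k| * e)) * m * (3 * r ^ 2 + ∑ i, w i ^ 2) := by
    calc _ = ∑ i, 2 * (-(A * θ) * r * w i * dψ i) := by
          simp only [Finset.mul_sum, ← Finset.sum_neg_distrib]
          exact Finset.sum_congr rfl fun i _ => by ring
      _ ≤ ∑ i, (A * (|k| * e)) * m * (r ^ 2 + w i ^ 2) := Finset.sum_le_sum fun i _ =>
          two_mul_le_of_abs_le hAθ (hdψ i)
      _ = _ := by simp only [Fin.sum_univ_three]; ring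
  have h4 : b * ((1 - k) * (∑ j, dv j j) * r ^ 2) ≤ 3 * (Λ * (1 + |k|)) * m * r ^ 2 := by
    calc _ = 2⁻¹ * ∑ j, 2 * (b * (1 - k) * r * r * dv j j) := by
          simp only [Fin.sum_univ_three]; ring
      _ ≤ 2⁻¹ * ∑ _j : Fin 3, Λ * (1 + |k|) * m * (r ^ 2 + r ^ 2) := by
          exact mul_le_mul_of_nonneg_left (Finset.sum_le_sum fun j _ =>
            two_mul_le_of_abs_le hb1k (hdv j j)) (by norm_num)
      _ = _ := by simp only [Fin.sum_univ_three]; ring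
  have h5 : - (b * (2 * r * ∑ j, w j * dψ j)) ≤ Λ * m * (3 * r ^ 2 + ∑ i, w i ^ 2) := by
    calc _ = ∑ i, 2 * (-b * r * w i * dψ i) := by
          simp only [Finset.mul_sum, ← Finset.sum_neg_distrib]
          exact Finset.sum_congr rfl fun i _ => by ring
      _ ≤ ∑ i, Λ * m * (r ^ 2 + w i ^ 2) := Finset.sum_le_sum fun i _ =>
          two_mul_le_of_abs_le hnb (hdψ i)
      _ = _ := by simp only [Fin.sum_univ_three]; ring
  have h6 : b * (2 * k * r * ∑ j, w j * dρ j) ≤ Λ * |k| * m * (3 * r ^ 2 + ∑ i, w i ^ 2) := by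
    calc _ = ∑ i, 2 * (b * k * r * w i * dρ i) := by
          simp only [Finset.mul_sum]
          exact Finset.sum_congr rfl fun i _ => by ring
      _ ≤ ∑ i, Λ * |k| * m * (r ^ 2 + w i ^ 2) := Finset.sum_le_sum fun i _ =>
          two_mul_le_of_abs_le hbk (hdρ i)
      _ = _ := by simp only [Fin.sum_univ_three]; ring
  have hW : 0 ≤ ∑ i, w i ^ 2 := Finset.sum_nonneg fun i _ => sq_nonneg _
  set W := ∑ i, w i ^ 2
  have hAk : 0 ≤ A * (|k| * e) := by positivity
  have hΛk : 0 ≤ Λ * |k| := by positivity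
  have hsum : C₁ * (W + r ^ 2) * m ≤ C₁ * (1 + β⁻¹) * m * (W + b * r ^ 2) := by
    have h7 : W + r ^ 2 ≤ (1 + β⁻¹) * (W + b * r ^ 2) := by
      have h8 : r ^ 2 ≤ β⁻¹ * (b * r ^ 2) := by
        rw [← div_eq_inv_mul, le_div_iff₀ hβ, mul_comm]
        gcongr
      have h9 : 0 ≤ β⁻¹ * W := by positivity
      have h10 : 0 ≤ b * r ^ 2 := by positivity
      linarith
    calc C₁ * (W + r ^ 2) * m ≤ C₁ * ((1 + β⁻¹) * (W + b * r ^ 2)) * m := by gcongr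
      _ = _ := by ring
  refine le_trans ?_ hsum
  have g1 : 0 ≤ m * W := by positivity
  have g2 : 0 ≤ m * r ^ 2 := by positivity
  have g3 := mul_nonneg hAk g1
  have g4 := mul_nonneg hΛ g1
  have g5 := mul_nonneg hΛk g1
  simp only [C₁]
  linarith

/-! ### The energy inequality for two solutions. -/

theorem valueAt_pairState (v φ : Fin 3 → L2) (ρ ψ : L2) (x : Space) :
    valueAt (pairState v ρ φ ψ) x
      = pairState (fun i => v i x) (ρ x) (fun i => φ i x) (ψ x) := by
  funext c
  rcases c with (c | c) | (c | c) <;> rfl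

theorem energyDensity_pairState (A k : ℝ) (v φ : Fin 3 → ℝ) (ρ ψ : ℝ) :
    energyDensity A k (pairState v ρ φ ψ)
      = ∑ i, (v i - φ i) ^ 2 + A * Real.exp (k * ρ) * (ρ - ψ) ^ 2 := rfl

theorem energyDensity_nonneg {A : ℝ} (hA : 0 ≤ A) (k : ℝ) (a : PairIndex → ℝ) :
    0 ≤ energyDensity A k a := by
  unfold energyDensity; positivity

theorem soundSpeed_sq {γ ρbar : ℝ} (hγ : 0 < γ) (hρbar : 0 < ρbar) (r : ℝ) :
    soundSpeed γ ρbar r ^ 2 = γ * ρbar ^ (γ - 1) * Real.exp ((γ - 1) * r) := by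
  have hd : 0 < density ρbar r := mul_pos hρbar (Real.exp_pos r)
  have h : deriv (pressure γ) (density ρbar r) = γ * density ρbar r ^ (γ - 1) :=
    (Real.hasDerivAt_rpow_const (Or.inl hd.ne')).deriv
  rw [soundSpeed, h, Real.sq_sqrt (by positivity), density,
    Real.mul_rpow hρbar.le (Real.exp_pos r).le, ← Real.exp_mul, mul_comm r]
  ring

/-- The time derivatives of a solution, and the system with the speed of sound made explicit. -/
theorem IsSolution.exists_timeDeriv {γ ρbar s T : ℝ} (hγ : 0 < γ) (hρbar : 0 < ρbar)
    {v : ℝ → Fin 3 → L2} {ρ : ℝ → L2} {ϖ : ℝ → Fin 3 → L2}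
    (h : IsSolution γ ρbar s T v ρ ϖ) {t : ℝ} (ht : t ∈ Icc 0 T) :
    ∃ (tv : Fin 3 → L2) (tρ : L2),
      (∀ i, HasDerivWithinAt (fun τ => v τ i) (tv i) (Icc 0 T) t) ∧
      HasDerivWithinAt ρ tρ (Icc 0 T) t ∧
      ∀ᵐ x : Space, (∀ i, tv i x + ∑ j, v t j x * weakDeriv j (v t i) x
          = - (γ * ρbar ^ (γ - 1) * Real.exp ((γ - 1) * ρ t x)) * weakDeriv i (ρ t) x) ∧
        tρ x + ∑ j, v t j x * weakDeriv j (ρ t) x = - ∑ j, weakDeriv j (v t j) x := by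
  choose tv htv hv using h.momentum t ht
  obtain ⟨tρ, htρ, hρ⟩ := h.continuity t ht
  refine ⟨tv, tρ, htv, htρ, ?_⟩
  filter_upwards [ae_all_iff.mpr hv, hρ] with x h1 h2
  exact ⟨fun i => by rw [h1 i, soundSpeed_sq hγ hρbar], h2⟩

/-- The sum of the `L^∞` norms of the first space derivatives of a family of functions. -/
noncomputable def gradientNorm (U : PairIndex → L2) : ℝ≥0∞ :=
  ∑ j, ∑ c, eLpNorm (weakDeriv j (U c)) ⊤ (volume : Measure Space)

theorem ae_abs_le_gradientNorm {U : PairIndex → L2} (h : gradientNorm U ≠ ⊤) :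
    ∀ᵐ x : Space, ∀ j c, |weakDeriv j (U c) x| ≤ (gradientNorm U).toReal := by
  rw [ae_all_iff]; intro j
  rw [ae_all_iff]; intro c
  have h1 : eLpNorm (weakDeriv j (U c)) ⊤ (volume : Measure Space) ≤ gradientNorm U :=
    (Finset.single_le_sum (f := fun c => eLpNorm (weakDeriv j (U c)) ⊤ (volume : Measure Space))
      (fun _ _ => zero_le) (Finset.mem_univ c)).trans
    (Finset.single_le_sum
      (f := fun j => ∑ c, eLpNorm (weakDeriv j (U c)) ⊤ (volume : Measure Space))
      (fun _ _ => zero_le) (Finset.mem_univ j))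
  rw [eLpNorm_exponent_top] at h1
  filter_upwards [enorm_ae_le_eLpNormEssSup (weakDeriv j (U c)) volume] with x hx
  rw [← Real.norm_eq_abs, ← toReal_enorm]
  exact ENNReal.toReal_mono h (hx.trans h1)

/-- The energy inequality at a time when the space derivatives of both solutions are bounded. -/
theorem energy_inequality {A k K C : ℝ}
    (hC : ∀ {w dρ dψ : Fin 3 → ℝ} {ρ ψ m : ℝ} {dv dφ : Fin 3 → Fin 3 → ℝ},
      |ρ| ≤ K → |ψ| ≤ K → (∀ i j, |dv j i| ≤ m) → (∀ i j, |dφ j i| ≤ m) → (∀ j, |dρ j| ≤ m) →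
      (∀ j, |dψ j| ≤ m) →
      (∑ j, dv j j) * ∑ i, w i ^ 2 - 2 * ∑ i, ∑ j, w i * w j * dφ j i
        - 2 * A * (Real.exp (k * ρ) - Real.exp (k * ψ)) * ∑ i, w i * dψ i
        + A * Real.exp (k * ρ) * ((1 - k) * (∑ j, dv j j) * (ρ - ψ) ^ 2
          - 2 * (ρ - ψ) * ∑ j, w j * dψ j + 2 * k * (ρ - ψ) * ∑ j, w j * dρ j)
      ≤ C * m * (∑ i, w i ^ 2 + A * Real.exp (k * ρ) * (ρ - ψ) ^ 2))
    {v φ tv tφ : Fin 3 → L2} {ρ ψ tρ tψ : L2} {u : PairIndex → ℕ → 𝓢(Space, ℝ)}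
    {L : ℝ} {L' : Fin 3 → ℝ}
    (hE : QuadraticOn (energyDensity A k) K L) (hF : ∀ j, QuadraticOn (energyFlux A k j) K (L' j))
    (hu : ∀ c, SchwartzApprox K (pairState v ρ φ ψ c)
      (fun j => weakDeriv j (pairState v ρ φ ψ c)) (u c))
    (h₁ : ∀ᵐ x : Space, (∀ i, tv i x + ∑ j, v j x * weakDeriv j (v i) x
          = - (A * Real.exp (k * ρ x)) * weakDeriv i ρ x) ∧
        tρ x + ∑ j, v j x * weakDeriv j ρ x = - ∑ j, weakDeriv j (v j) x)
    (h₂ : ∀ᵐ x : Space, (∀ i, tφ i x + ∑ j, φ j x * weakDeriv j (φ i) x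
          = - (A * Real.exp (k * ψ x)) * weakDeriv i ψ x) ∧
        tψ x + ∑ j, φ j x * weakDeriv j ψ x = - ∑ j, weakDeriv j (φ j) x)
    (hfin : gradientNorm (pairState v ρ φ ψ) ≠ ⊤) :
    ∫ x, fderiv ℝ (energyDensity A k) (valueAt (pairState v ρ φ ψ) x)
        (valueAt (pairState tv tρ tφ tψ) x)
      ≤ C * (gradientNorm (pairState v ρ φ ψ)).toReal
        * ∫ x, energyDensity A k (valueAt (pairState v ρ φ ψ) x) := by
  set U := pairState v ρ φ ψ with hUdef
  have hU : BoundedBy K U := boundedBy_of_forall hE.nonneg_radius fun c => (hu c).ae_abs_le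
  have hEi := integrable_fderiv_valueAt_apply hE hU (pairState tv tρ tφ tψ)
  have hFi : ∀ j, Integrable (fun x => fderiv ℝ (energyFlux A k j) (valueAt U x)
      (valueAt (fun c => weakDeriv j (U c)) x)) (volume : Measure Space) := fun j =>
    integrable_fderiv_valueAt_apply (hF j) hU _
  have hFsum : ∫ x, ∑ j, fderiv ℝ (energyFlux A k j) (valueAt U x)
      (valueAt (fun c => weakDeriv j (U c)) x) = 0 := by
    rw [integral_finsetSum _ fun j _ => hFi j]
    exact Finset.sum_eq_zero fun j _ => integral_fderiv_comp_weakDeriv (hF j) hu j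
  -- Adding the divergence of the flux, whose integral is zero, makes the integrand the left side of
  -- `energy_identity`.
  rw [← integral_const_mul, ← add_zero (∫ x, fderiv ℝ (energyDensity A k) _ _), ← hFsum,
    ← integral_add hEi (integrable_finsetSum _ fun j _ => hFi j)]
  refine integral_mono_ae (hEi.add (integrable_finsetSum _ fun j _ => hFi j))
    ((integrable_comp_valueAt hE hU).const_mul _) ?_
  filter_upwards [hU, h₁, h₂, ae_abs_le_gradientNorm hfin] with x hx h1 h2 h3
  have hder : ∀ j, valueAt (fun c => weakDeriv j (U c)) x
      = pairState (fun i => weakDeriv j (v i) x) (weakDeriv j ρ x)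
        (fun i => weakDeriv j (φ i) x) (weakDeriv j ψ x) := fun j => by
    funext c
    rcases c with (c | c) | (c | c) <;> rfl
  have hK := (pi_norm_le_iff_of_nonneg hE.nonneg_radius).mp hx
  simp only [hder]
  rw [hUdef, valueAt_pairState, valueAt_pairState, energyDensity_pairState]
  refine (energy_identity A k (dv := fun j i => weakDeriv j (v i) x)
    (dφ := fun j i => weakDeriv j (φ i) x) h1.1 h2.1 h1.2 h2.2).trans_le ?_
  exact hC (hK (.inl (.inr ()))) (hK (.inr (.inr ()))) (fun i j => h3 j (.inl (.inl i)))
    (fun i j => h3 j (.inr (.inl i))) (fun j => h3 j (.inl (.inr ())))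
    (fun j => h3 j (.inr (.inr ())))

theorem aemeasurable_gradientNorm {T : ℝ} {U : ℝ → PairIndex → L2}
    (hU : ∀ j c, ContinuousOn (fun t => weakDeriv j (U t c)) (Icc 0 T)) :
    AEMeasurable (fun t => gradientNorm (U t)) (volume.restrict (Icc 0 T)) :=
  Finset.aemeasurable_fun_sum _ fun j _ => Finset.aemeasurable_fun_sum _ fun c _ =>
    aemeasurable_eLpNorm_top (hU j c)

theorem lintegral_gradientNorm_lt_top {T : ℝ} {U : ℝ → PairIndex → L2}
    (hU : ∀ j c, ContinuousOn (fun t => weakDeriv j (U t c)) (Icc 0 T))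
    (h : ∀ j c, normSqL2Linfty T (fun t => weakDeriv j (U t c)) < ⊤) :
    ∫⁻ t in Icc 0 T, gradientNorm (U t) < ⊤ := by
  simp only [gradientNorm]
  rw [lintegral_finsetSum' _ fun j _ => Finset.aemeasurable_fun_sum _ fun c _ =>
    aemeasurable_eLpNorm_top (hU j c)]
  refine ENNReal.sum_lt_top.mpr fun j _ => ?_
  rw [lintegral_finsetSum' _ fun c _ => aemeasurable_eLpNorm_top (hU j c)]
  exact ENNReal.sum_lt_top.mpr fun c _ => lintegral_lt_top_of_normSqL2Linfty (h j c)

/-! ### Uniqueness. -/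

theorem HsNormLE.mono {s C C' : ℝ} {f : L2} (h : HsNormLE s f C) (hC : C ≤ C') :
    HsNormLE s f C' := by
  obtain ⟨g, hg, hgC⟩ := h
  exact ⟨g, hg, hgC.trans hC⟩

theorem eq_of_integral_energyDensity_eq_zero {A k K L : ℝ} (hA : 0 < A)
    (hE : QuadraticOn (energyDensity A k) K L) {v φ : Fin 3 → L2} {ρ ψ : L2}
    (hU : BoundedBy K (pairState v ρ φ ψ))
    (h : ∫ x, energyDensity A k (valueAt (pairState v ρ φ ψ) x) = 0) : v = φ ∧ ρ = ψ := by
  rw [integral_eq_zero_iff_of_nonneg (fun x => energyDensity_nonneg hA.le k _)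
    (integrable_comp_valueAt hE hU)] at h
  have h' : ∀ᵐ x : Space, (∀ i, v i x = φ i x) ∧ ρ x = ψ x := by
    filter_upwards [h] with x hx
    rw [valueAt_pairState, energyDensity_pairState] at hx
    have h1 : 0 ≤ ∑ i, (v i x - φ i x) ^ 2 := Finset.sum_nonneg fun _ _ => sq_nonneg _
    have hb : 0 < A * Real.exp (k * ρ x) := by positivity
    have h2 : 0 ≤ A * Real.exp (k * ρ x) * (ρ x - ψ x) ^ 2 := by positivity
    obtain ⟨h3, h4⟩ := (add_eq_zero_iff_of_nonneg h1 h2).mp hx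
    refine ⟨fun i => ?_, ?_⟩
    · exact sub_eq_zero.mp (pow_eq_zero_iff two_ne_zero |>.mp
        ((Finset.sum_eq_zero_iff_of_nonneg fun _ _ => sq_nonneg _).mp h3 i (Finset.mem_univ i)))
    · exact sub_eq_zero.mp (pow_eq_zero_iff two_ne_zero |>.mp
        ((mul_eq_zero.mp h4).resolve_left hb.ne'))
  exact ⟨funext fun i => Lp.ext (h'.mono fun x hx => hx.1 i), Lp.ext (h'.mono fun x hx => hx.2)⟩

/-- Two solutions with the same initial velocity and density have the same velocity and density. -/
theorem IsSolution.eq_of_initial_eq {γ ρbar s T : ℝ} (hγ : 0 < γ) (hρbar : 0 < ρbar)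
    (hs : 2 ≤ s) {v φ : ℝ → Fin 3 → L2} {ρ ψ : ℝ → L2} {ϖ V : ℝ → Fin 3 → L2}
    (h₁ : IsSolution γ ρbar s T v ρ ϖ) (h₂ : IsSolution γ ρbar s T φ ψ V)
    (hv : v 0 = φ 0) (hρ : ρ 0 = ψ 0) {t : ℝ} (ht : t ∈ Icc 0 T) : v t = φ t ∧ ρ t = ψ t := by
  obtain ⟨C₁, hC₁⟩ := h₁.sobolev_bound
  obtain ⟨C₂, hC₂⟩ := h₂.sobolev_bound
  let U : ℝ → PairIndex → L2 := fun t => pairState (v t) (ρ t) (φ t) (ψ t)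
  have hb : ∀ τ ∈ Icc 0 T, ∀ c, HsNormLE s (U τ c) (max C₁ C₂) := fun τ hτ c => by
    rcases c with (c | c) | (c | c)
    exacts [((hC₁ τ hτ).1 c).mono (le_max_left _ _), (hC₁ τ hτ).2.mono (le_max_left _ _),
      ((hC₂ τ hτ).1 c).mono (le_max_right _ _), (hC₂ τ hτ).2.mono (le_max_right _ _)]
  obtain ⟨K₀, hK₀, happ⟩ := HsNormLE.exists_schwartzApprox_weakDeriv hs
  -- One `K`, independent of time, bounds both solutions and their approximants and is the radius of
  -- the ball for the Taylor estimates.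
  let K := K₀ * (max C₁ C₂ + 1)
  have hK : 0 ≤ K := by
    obtain ⟨g, -, hg⟩ := hb t ht (.inl (.inr ()))
    have : 0 ≤ max C₁ C₂ := (norm_nonneg g).trans hg
    positivity
  have hu : ∀ τ ∈ Icc 0 T, ∀ c, ∃ u : ℕ → 𝓢(Space, ℝ),
      SchwartzApprox K (U τ c) (fun j => weakDeriv j (U τ c)) u := fun τ hτ c =>
    happ _ _ (hb τ hτ c)
  have hUb : ∀ τ ∈ Icc 0 T, BoundedBy K (U τ) := fun τ hτ =>
    boundedBy_of_forall hK fun c => (hu τ hτ c).choose_spec.ae_abs_le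
  -- With these `A` and `k`, the weight `A e^{kρ}` is the squared speed of sound.
  let A := γ * ρbar ^ (γ - 1)
  have hA : 0 < A := by positivity
  let k := γ - 1
  obtain ⟨L, hE⟩ := exists_quadraticOn (contDiff_energyDensity A k (n := 2))
    (energyDensity_zero A k) (fderiv_energyDensity_zero A k) hK
  choose L' hF using fun j => exists_quadraticOn (contDiff_energyFlux A k j (n := 2))
    (energyFlux_zero A k j) (fderiv_energyFlux_zero A k j) hK
  obtain ⟨C, hC0, hC⟩ := exists_energy_bound hA k K
  -- Time derivatives exist at every time, but the estimate is claimed only where the gradient norm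
  -- is finite, since `toReal` sends `⊤` to `0`.
  have hpair : ∀ τ ∈ Icc 0 T, ∃ W : PairIndex → L2,
      (∀ c, HasDerivWithinAt (fun τ => U τ c) (W c) (Icc 0 T) τ) ∧
      (gradientNorm (U τ) ≠ ⊤ →
        ∫ x, fderiv ℝ (energyDensity A k) (valueAt (U τ) x) (valueAt W x)
          ≤ C * (gradientNorm (U τ)).toReal * ∫ x, energyDensity A k (valueAt (U τ) x)) := by
    intro τ hτ
    obtain ⟨tv, tρ, hv1, hv2, hv3⟩ := h₁.exists_timeDeriv hγ hρbar hτ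
    obtain ⟨tφ, tψ, hφ1, hφ2, hφ3⟩ := h₂.exists_timeDeriv hγ hρbar hτ
    refine ⟨pairState tv tρ tφ tψ, fun c => ?_, ?_⟩
    · rcases c with (c | c) | (c | c)
      exacts [hv1 c, hv2, hφ1 c, hφ2]
    · choose u hu using hu τ hτ
      exact energy_inequality hC hE hF hu hv3 hφ3
  choose! W hW hineq using hpair
  have hcont : ∀ c, ContinuousOn (fun τ => U τ c) (Icc 0 T) := fun c τ hτ =>
    (hW τ hτ c).continuousWithinAt
  have hdcont : ∀ j c, ContinuousOn (fun τ => weakDeriv j (U τ c)) (Icc 0 T) := fun j c =>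
    continuousOn_weakDeriv hs (hcont c) (fun τ hτ => hb τ hτ c) j
  have hmeas := aemeasurable_gradientNorm hdcont
  have hlint : ∫⁻ τ in Icc 0 T, gradientNorm (U τ) < ⊤ :=
    lintegral_gradientNorm_lt_top hdcont fun j c => by
      rcases c with (c | c) | (c | c)
      exacts [h₁.velocity_strichartz c j, h₁.density_strichartz j, h₂.velocity_strichartz c j,
        h₂.density_strichartz j]
  have hzero := eq_zero_of_deriv_le_mul
    (E := fun τ => ∫ x, energyDensity A k (valueAt (U τ) x))
    (a := fun τ => C * (gradientNorm (U τ)).toReal)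
    (fun τ hτ => hasDerivWithinAt_integral_comp hE hτ hUb (hW τ hτ)) (by
      simp only [U, valueAt_pairState, energyDensity_pairState, hv, hρ]
      simp)
    (fun τ _ => integral_nonneg fun x => energyDensity_nonneg hA.le k _)
    (fun τ => by positivity)
    ((integrable_toReal_of_lintegral_ne_top hmeas hlint.ne).const_mul C) (by
      -- Integrability makes the gradient norm finite at almost every time.
      filter_upwards [ae_lt_top' hmeas hlint.ne, ae_restrict_mem measurableSet_Icc] with τ h1 h2
      exact hineq τ h2 h1.ne) t ht
  exact eq_of_integral_energyDensity_eq_zero hA hE (hUb t ht) hzero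

end CompressibleEuler

theorem corollary3p5 (γ ρbar s s₀ T : ℝ) (hγ : 0 < γ) (hρbar : 0 < ρbar)
    (hs₀ : 2 < s₀) (hs : s₀ < s) (hT : 0 < T)
    -- the initial data, and their specific vorticity
    (v₀ : Fin 3 → L2) (ρ₀ : L2) (ϖ₀ : Fin 3 → L2)
    (hv₀ : ∀ i, MemHs s (v₀ i)) (hρ₀ : MemHs s ρ₀)
    (hϖ₀ : IsSpecificVorticity ρbar v₀ ρ₀ ϖ₀) (hϖ₀s : ∀ i, MemHs s₀ (ϖ₀ i))
    -- two solutions with these data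
    (v φ : ℝ → Fin 3 → L2) (ρ ψ : ℝ → L2) (ϖ V : ℝ → Fin 3 → L2)
    (h₁ : IsSolution γ ρbar s T v ρ ϖ) (h₂ : IsSolution γ ρbar s T φ ψ V)
    (hv : v 0 = v₀) (hρ : ρ 0 = ρ₀) (hφ : φ 0 = v₀) (hψ : ψ 0 = ρ₀) :
    ∀ t ∈ Icc 0 T, v t = φ t ∧ ρ t = ψ t ∧ ϖ t = V t := by
  intro t ht
  obtain ⟨hvt, hρt⟩ := h₁.eq_of_initial_eq hγ hρbar (hs₀.trans hs).le h₂ (hv.trans hφ.symm)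
    (hρ.trans hψ.symm) ht
  refine ⟨hvt, hρt, funext fun i => Lp.ext ?_⟩
  filter_upwards [h₁.vorticity t ht i, h₂.vorticity t ht i] with x h3 h4
  rw [h3, h4, hvt, hρt]
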